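/- **Setting.** Let $X$ be a compact metrizable space, $\Phi^t:X\to X$ ($t\in\mathbb R$) a continuous flow, $\mu$ a $\Phi^t$-invariant Borel probability measure, and $\Delta t>0$ such that $\Phi^{\Delta t}$ is ergodic for $\mu$. Put $H=L^2(X,\mu)$, $\mathfrak B=B(H)$, and assume $H$ is infinite-dimensional. For $x_0\in X$ let $x_n=\Phi^{n\Delta t}(x_0)$, $\mu_N=\frac1N\sum_{n<N}\delta_{x_n}$, $\hat H_N=L^2(X,\mu_N)$ with inner product $\langle\cdot,\cdot\rangle_N$, and let $\iota:C(X)\to H$, $\iota_N:C(X)\to\hat H_N$ be the canonical maps. Let $h:X\to Y$ be a continuous map to a topological space. *Bases.* Let $k,k_N:X\times X\to\mathbb R$ be continuous symmetric kernels, where $k_N$ may depend on $x_0$ and, for $\mu$-a.e. $x_0$, $k_N\to k$ uniformly. Let $Kf=\int k(\cdot,x)f(x)\,d\mu(x)$ on $H$ and $K_Nf=\int k_N(\cdot,x)f(x)\,d\mu_N(x)$ on $\hat H_N$. Let $\{\phi_l\}_{l\ge0}$ be a real orthonormal basis of $H$ with $K\phi_l=\lambda_l\phi_l$ (for instance with $|\lambda_l|$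 decreasing); if $\lambda_l\ne0$, $\phi_l$ has the continuous representative $\varphi_l=\lambda_l^{-1}\int k(\cdot,x)\phi_l(x)\,d\mu(x)$. Let $\{e_{l,N}\}_{l<N}$ be a real orthonormal basis of $\hat H_N$ with $K_Ne_{l,N}=\lambda_{l,N}e_{l,N}$ and $|\lambda_{l,N}|$ decreasing in $l$. A family of real orthogonal $N\times N$ matrices $O_N$ is called *adapted* if $\phi_{l,N}=\sum_m(O_N)_{lm}e_{m,N}$ satisfies, for every $l$ with $\lambda_l\neq0$: (i) for every $\epsilon>0$ and all large $N$, $(O_N)_{lm}\ne0$ implies $|\lambda_{m,N}-\lambda_l|<\epsilon$; (ii) the continuous representatives $\varphi_{l,N}=\sum_m(O_N)_{lm}\lambda_{m,N}^{-1}\int k_N(\cdot,x)e_{m,N}(x)\,d\mu_N(x)$ converge to $\varphi_l$ uniformly on $X$. (Here $\lambda_{m,N}^{-1}:=0$ if $\lambda_{m,N}=0$. If the $e_{l,N}$ themselves converge one can take $O_N=I$.) Let $\Pi_L$, $\Pi_{L,N}$ be the orthogonal projections on $\mathrm{span}\{\phi_0,\dots,\phi_{L-1}\}\subset H$ and $\mathrm{span}\{\phi_{0,N},\dots,\phi_{L-1,N}\}\subset\hat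 H_N$. *Effects.* Let $\psi,\psi_N:Y\times Y\to[0,1]$ be continuous and symmetric, where $\psi_N$ may depend on $x_0$ and, for $\mu$-a.e. $x_0$, $\psi_N(h(x),h(x'))\to\psi(h(x),h(x'))$ uniformly in $(x,x')\in X\times X$. For $y\in Y$ let $\mathcal F(y)$ and $\hat{\mathcal F}_N(y)$ be the multiplication operators by $\psi(y,h(\cdot))$ on $H$ and by $\psi_N(y,h(\cdot))$ on $\hat H_N$, and put $\mathcal F_L(y)=\Pi_L\mathcal F(y)\Pi_L$, $\mathcal F_{L,N}(y)=\Pi_{L,N}\hat{\mathcal F}_N(y)\Pi_{L,N}$. *States.* For a density operator $\rho$ and an operator $0\le e\le I$ with $\mathrm{tr}(\rho e)\ne0$, the state $\omega_\rho=\mathrm{tr}(\rho\,\cdot)$ conditioned by $e$ is $\omega_\rho|_e=\omega_{\rho|_e}$ with $\rho|_e=\sqrt e\,\rho\sqrt e/\mathrm{tr}(\rho e)$. The class $S_C(\mathfrak B)$ consists of the states $\omega_\rho$ with $\rho=\sum_{j\ge0} r_j\langle\xi_j,\cdot\rangle\xi_j$, where $r_j\in[0,1]$, $\sum_j r_j=1$,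 and $\{\xi_j\}$ is an orthonormal basis of $H$ with $\xi_j=\iota\tilde\xi_j$, $\tilde\xi_j\in C(X)$, $\sup_j\|\tilde\xi_j\|_{C(X)}<\infty$. For such a $\rho$ and a fixed such decomposition put $\hat\sigma_N=\sum_j r_j\langle\iota_N\tilde\xi_j,\cdot\rangle_N\,\iota_N\tilde\xi_j$, $C_L=\mathrm{tr}(\Pi_L\rho\,\Pi_L)$, $C_{L,N}=\mathrm{tr}(\Pi_{L,N}\hat\sigma_N\Pi_{L,N})$, $\rho_L=\Pi_L\rho\,\Pi_L/C_L$, $\rho_{L,N}=\Pi_{L,N}\hat\sigma_N\Pi_{L,N}/C_{L,N}$. **Proposition.** Let $\omega_\rho\in S_C(\mathfrak B)$ and $y\in Y$. (a) Suppose that $y\in h(X)$ or, more generally, that for $\mu$-a.e. $x_0$, $\psi_N(y,h(\cdot))\to\psi(y,h(\cdot))$ uniformly on $X$. Then for $\mu$-a.e. $x_0\in X$ the following holds for all eigenbases $\{e_{l,N}\}$ as above. An adapted family $(O_N)$ exists; and for every adapted family and every $L$ such that $\lambda_0,\dots,\lambda_{L-1}\ne0$, $C_L\neq0$ and $\mathrm{tr}(\rho_L\mathcal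 F_L(y))\ne0$, we have $C_{L,N}\ne0$ and $\mathrm{tr}(\rho_{L,N}\mathcal F_{L,N}(y))\neq0$ for all large $N$, and the $L\times L$ matrices satisfy $$\lim_{N\to\infty}\big[\langle\phi_{i,N},\ \rho_{L,N}|_{\mathcal F_{L,N}(y)}\,\phi_{j,N}\rangle_N\big]_{i,j<L}=\big[\langle\phi_i,\ \rho_L|_{\mathcal F_L(y)}\,\phi_j\rangle\big]_{i,j<L}.$$ (b) If $\mathrm{tr}(\rho\,\mathcal F(y))\ne0$, then $C_L\ne0$ and $\mathrm{tr}(\rho_L\mathcal F_L(y))\neq0$ for all large $L$, and $\omega_{\rho_L}|_{\mathcal F_L(y)}$ converges to $\omega_\rho|_{\mathcal F(y)}$ in trace norm: $$\lim_{L\to\infty}\mathrm{tr}\,\big|\rho_L|_{\mathcal F_L(y)}-\rho|_{\mathcal F(y)}\big|=0.$$ -/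

import Mathlib

open MeasureTheory Filter Topology
open scoped ENNReal NNReal

noncomputable section

namespace QMDA

/-! ### Traces and conditioning of operators on a complex Hilbert space -/

section Operators

variable {H : Type*} [NormedAddCommGroup H] [InnerProductSpace ℂ H] [CompleteSpace H]

/-- An orthonormal basis of the Hilbert space `H`, as a set of vectors. -/
def refBasis (H : Type*) [NormedAddCommGroup H] [InnerProductSpace ℂ H] [CompleteSpace H] :
    Set H :=
  (exists_hilbertBasis ℂ H).choose

theorem refBasis_spec (H : Type*) [NormedAddCommGroup H] [InnerProductSpace ℂ H]
    [CompleteSpace H] :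
    ∃ b : HilbertBasis (refBasis H) ℂ H, ⇑b = ((↑) : refBasis H → H) :=
  (exists_hilbertBasis ℂ H).choose_spec

/-- The trace `tr T = ∑ ⟨eᵢ, T eᵢ⟩` of a trace-class operator (it is only ever used for such
operators, for which it does not depend on the orthonormal basis). -/
def opTrace (T : H →L[ℂ] H) : ℂ :=
  ∑' v : refBasis H, inner ℂ (v : H) (T v)

/-- The trace norm `‖T‖₁ = tr √(T* T)`, with value `∞` if `T` is not of trace class. -/
def traceNorm (T : H →L[ℂ] H) : ℝ≥0∞ :=
  ∑' v : refBasis H, ENNReal.ofReal (inner ℂ (v : H) (CFC.abs T v)).re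

/-- Density operators: positive trace-class operators of trace one. -/
structure IsDensityOperator (ρ : H →L[ℂ] H) : Prop where
  nonneg : 0 ≤ ρ
  traceClass : traceNorm ρ < ∞
  trace_eq_one : opTrace ρ = 1

/-- The normalization `T / tr T`. -/
def normalize (T : H →L[ℂ] H) : H →L[ℂ] H :=
  (opTrace T)⁻¹ • T

/-- The validity `ω_ρ e = tr (ρ e)` of the effect `e` in the state `ω_ρ`. -/
def validity (ρ e : H →L[ℂ] H) : ℂ :=
  opTrace (ρ * e)

/-- The density operator `√e ρ √e / tr (ρ e)` of the state `ω_ρ` conditioned by the effect `e`;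
it is meaningful if the validity of `e` is nonzero. -/
def condition (ρ e : H →L[ℂ] H) : H →L[ℂ] H :=
  (validity ρ e)⁻¹ • (CFC.sqrt e * ρ * CFC.sqrt e)

/-- The span of the first `L` of the vectors `φ 0, φ 1, …`. -/
def leadingSpan (φ : ℕ → H) (L : ℕ) : Submodule ℂ H :=
  Submodule.span ℂ (Set.range fun l : Fin L => φ l)

instance leadingSpan_finiteDimensional (φ : ℕ → H) (L : ℕ) :
    FiniteDimensional ℂ (leadingSpan φ L) :=
  FiniteDimensional.span_of_finite ℂ (Set.finite_range _)

/-- The compression `Π_L A Π_L`, where `Π_L` is the orthogonal projection on the span of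
`φ 0, …, φ (L - 1)`. Operators on this span are identified with operators on `H` by extending
them by zero on the orthogonal complement. -/
def compress (φ : ℕ → H) (L : ℕ) (A : H →L[ℂ] H) : H →L[ℂ] H :=
  (leadingSpan φ L).starProjection * A * (leadingSpan φ L).starProjection

/-- The matrix `[⟨φ i, A φ j⟩]` with `i, j < L`. -/
def matrixRep (φ : ℕ → H) (L : ℕ) (A : H →L[ℂ] H) : Matrix (Fin L) (Fin L) ℂ :=
  Matrix.of fun i j => inner ℂ (φ i) (A (φ j))

end Operators

/-! ### The spaces `L²(X, ν)`, multiplication operators and kernel integral operators -/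

section Spaces

variable {X : Type*} [TopologicalSpace X] [CompactSpace X] [TopologicalSpace.MetrizableSpace X]
  [MeasurableSpace X] [BorelSpace X]

/-- The map sending a continuous function to its class in `L²(X, ν)`. -/
def iota (ν : Measure X) [IsFiniteMeasure ν] : C(X, ℂ) →L[ℂ] Lp ℂ 2 ν :=
  ContinuousMap.toLp 2 ν ℂ

/-- The regular representation of `L^∞(X, ν)` by multiplication operators on `L²(X, ν)`. -/
def mulRep (ν : Measure X) : Lp ℂ ∞ ν →L[ℂ] (Lp ℂ 2 ν →L[ℂ] Lp ℂ 2 ν) :=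
  (ContinuousLinearMap.mul ℂ ℂ).holderL ν ∞ 2 2

/-- An element of `L²(X, ν)` that is real-valued. -/
def IsRealVec {ν : Measure X} (f : Lp ℂ 2 ν) : Prop :=
  ∀ᵐ x ∂ν, (f x).im = 0

/-- The continuous function `x ↦ ∫ k(x, x') f(x') dν(x')`. -/
def kernelInt (ν : Measure X) [IsFiniteMeasure ν] (k : C(X × X, ℝ)) (f : Lp ℂ 2 ν) :
    C(X, ℂ) where
  toFun x := ∫ x', (k (x, x') : ℂ) * f x' ∂ν
  continuous_toFun := by
    have hf : Integrable (fun x' => f x') ν :=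
      (Lp.memLp f).integrable (by norm_num)
    refine continuous_of_dominated (bound := fun x' => ‖k‖ * ‖f x'‖) ?_ ?_ ?_ ?_
    · intro x
      have hk : Continuous fun x' => (k (x, x') : ℂ) := by fun_prop
      exact hk.aestronglyMeasurable.mul hf.aestronglyMeasurable
    · intro x
      refine Eventually.of_forall fun x' => ?_
      rw [norm_mul, Complex.norm_real]
      exact mul_le_mul_of_nonneg_right (k.norm_coe_le_norm _) (norm_nonneg _)
    · exact hf.norm.const_mul _
    · exact Eventually.of_forall fun x' => by fun_prop

/-- The integral operator of the kernel `k` on `L²(X, ν)`. -/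
def kernelOp (ν : Measure X) [IsFiniteMeasure ν] (k : C(X × X, ℝ)) (f : Lp ℂ 2 ν) : Lp ℂ 2 ν :=
  iota ν (kernelInt ν k f)

/-- The continuous representative `λ⁻¹ ∫ k(·, x') f(x') dν(x')` of an eigenvector `f` of the
integral operator for the nonzero eigenvalue `λ`. -/
def contRep (ν : Measure X) [IsFiniteMeasure ν] (k : C(X × X, ℝ)) (lam : ℝ) (f : Lp ℂ 2 ν) :
    C(X, ℂ) :=
  ((lam : ℂ)⁻¹) • kernelInt ν k f

/-- The function `x ↦ ψ(y, h(x))` on `X`. -/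
def featureFun {Y : Type*} [TopologicalSpace Y] (ψ : C(Y × Y, unitInterval)) (h : C(X, Y))
    (y : Y) : C(X, ℂ) where
  toFun x := (((ψ (y, h x) : unitInterval) : ℝ) : ℂ)
  continuous_toFun := by fun_prop

/-- The effect `π(F(y))`: multiplication by the class of `ψ(y, h(·))` in `L^∞(X, ν)`. -/
def effect {Y : Type*} [TopologicalSpace Y] (ν : Measure X) [IsFiniteMeasure ν]
    (ψ : C(Y × Y, unitInterval)) (h : C(X, Y)) (y : Y) : Lp ℂ 2 ν →L[ℂ] Lp ℂ 2 ν :=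
  mulRep ν (ContinuousMap.toLp ∞ ν ℂ (featureFun ψ h y))

/-- A diagonalization `ρ = ∑ⱼ rⱼ ⟨ξⱼ, ·⟩ ξⱼ` of a density operator in which the vectors `ξⱼ` of the
orthonormal basis have uniformly bounded continuous representatives. A normal state `ω_ρ` belongs to
the class `S_C` if and only if `ρ` has such a diagonalization. -/
structure ContinuousDiagonalization (μ : Measure X) [IsFiniteMeasure μ]
    (ρ : Lp ℂ 2 μ →L[ℂ] Lp ℂ 2 μ) where
  r : ℕ → ℝ
  ξ : HilbertBasis ℕ ℂ (Lp ℂ 2 μ)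
  rep : ℕ → C(X, ℂ)
  bound : ℝ
  r_mem : ∀ j, r j ∈ Set.Icc (0 : ℝ) 1
  r_summable : Summable r
  hasSum : HasSum (fun j => (r j : ℂ) • InnerProductSpace.rankOne ℂ (ξ j) (ξ j)) ρ
  iota_rep : ∀ j, iota μ (rep j) = ξ j
  norm_rep_le : ∀ j, ‖rep j‖ ≤ bound

/-- The data-driven operator `∑ⱼ rⱼ ⟨ξⱼ, ·⟩ ξⱼ` on `L²(X, ν)`, where now `ξⱼ` is the class in
`L²(X, ν)` of the continuous representative. -/
def ContinuousDiagonalization.dataOp {μ : Measure X} [IsFiniteMeasure μ]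
    {ρ : Lp ℂ 2 μ →L[ℂ] Lp ℂ 2 μ} (D : ContinuousDiagonalization μ ρ)
    (ν : Measure X) [IsFiniteMeasure ν] : Lp ℂ 2 ν →L[ℂ] Lp ℂ 2 ν :=
  ∑' j, (D.r j : ℂ) • InnerProductSpace.rankOne ℂ (iota ν (D.rep j)) (iota ν (D.rep j))

/-! ### Empirical measures and data-driven bases -/

/-- The sampling measure `μ_N = N⁻¹ ∑_{n < N} δ_{xₙ}` on the orbit `xₙ = Φ^{n Δt}(x₀)`. -/
def empMeasure (Φ : Flow ℝ X) (Δt : ℝ) (x₀ : X) (N : ℕ) : Measure X :=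
  (N : ℝ≥0)⁻¹ • ∑ n ∈ Finset.range N, Measure.dirac (Φ (n * Δt) x₀)

instance empMeasure_isFiniteMeasure (Φ : Flow ℝ X) (Δt : ℝ) (x₀ : X) (N : ℕ) :
    IsFiniteMeasure (empMeasure Φ Δt x₀ N) := by
  unfold empMeasure
  infer_instance

/-- The Hilbert space `L²(X, μ_N)`. -/
abbrev DataSpace (Φ : Flow ℝ X) (Δt : ℝ) (x₀ : X) (N : ℕ) : Type _ :=
  Lp ℂ 2 (empMeasure Φ Δt x₀ N)

/-- For every `N`, `e N` is a real orthonormal basis of `L²(X, μ_N)` consisting of eigenvectors of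
the integral operator of `kN N`, and `lamN N` lists the eigenvalues in order of decreasing
modulus. -/
structure IsDataEigenbasis (Φ : Flow ℝ X) (Δt : ℝ) (x₀ : X) (kN : ℕ → C(X × X, ℝ))
    (lamN : ∀ N, Fin N → ℝ)
    (e : ∀ N, OrthonormalBasis (Fin N) ℂ (DataSpace Φ Δt x₀ N)) : Prop where
  isReal : ∀ N l, IsRealVec (e N l)
  eigen : ∀ N l, kernelOp (empMeasure Φ Δt x₀ N) (kN N) (e N l) = (lamN N l : ℂ) • e N l
  antitone : ∀ N, Antitone fun l => |lamN N l|

/-- The vectors `φ_{l,N} = ∑ₘ O_{lm} e_{m,N}` for `l < N` (and `0` for `l ≥ N`). -/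
def rotBasis {Φ : Flow ℝ X} {Δt : ℝ} {x₀ : X}
    (e : ∀ N, OrthonormalBasis (Fin N) ℂ (DataSpace Φ Δt x₀ N))
    (O : ∀ N, Matrix (Fin N) (Fin N) ℝ) (N l : ℕ) : DataSpace Φ Δt x₀ N :=
  if hl : l < N then ∑ m, (O N ⟨l, hl⟩ m : ℂ) • e N m else 0

/-- The continuous representative of `φ_{l,N}` obtained from those of the eigenvectors. -/
def rotRep {Φ : Flow ℝ X} {Δt : ℝ} {x₀ : X} (kN : ℕ → C(X × X, ℝ)) (lamN : ∀ N, Fin N → ℝ)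
    (e : ∀ N, OrthonormalBasis (Fin N) ℂ (DataSpace Φ Δt x₀ N))
    (O : ∀ N, Matrix (Fin N) (Fin N) ℝ) (N l : ℕ) : C(X, ℂ) :=
  if hl : l < N then
    ∑ m, (O N ⟨l, hl⟩ m : ℂ) • contRep (empMeasure Φ Δt x₀ N) (kN N) (lamN N m) (e N m)
  else 0

/-- The orthogonal matrices `O N` rotate the eigenbases `e N` to bases adapted to the eigenvectors
`φ l` of the limit kernel: for `lam l ≠ 0`, the vector `φ_{l,N}` is a combination of eigenvectors
with eigenvalues converging to `lam l`, and its continuous representative converges uniformly on `X`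
to the continuous representative of `φ l`. If the eigenvectors `e_{l,N}` themselves converge, then
all `O N` can be the identity. -/
structure IsAdaptedRotation {Φ : Flow ℝ X} {Δt : ℝ} {x₀ : X} (μ : Measure X) [IsFiniteMeasure μ]
    (k : C(X × X, ℝ)) (lam : ℕ → ℝ) (φ : ℕ → Lp ℂ 2 μ) (kN : ℕ → C(X × X, ℝ))
    (lamN : ∀ N, Fin N → ℝ) (e : ∀ N, OrthonormalBasis (Fin N) ℂ (DataSpace Φ Δt x₀ N))
    (O : ∀ N, Matrix (Fin N) (Fin N) ℝ) : Prop where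
  orthogonal : ∀ N, O N ∈ Matrix.orthogonalGroup (Fin N) ℝ
  cluster : ∀ l, lam l ≠ 0 → ∀ ε > 0, ∀ᶠ N in atTop, ∀ (hl : l < N) (m : Fin N),
    O N ⟨l, hl⟩ m ≠ 0 → |lamN N m - lam l| < ε
  tendsto_rep : ∀ l, lam l ≠ 0 →
    Tendsto (fun N => rotRep kN lamN e O N l) atTop (𝓝 (contRep μ k (lam l) (φ l)))

end Spaces

end QMDA

end

/-! Both parts rest on writing trace-class operators as sums of rank-one operators `∑ ⟨b j, ·⟩ a j`
with `∑ ‖b j‖ ‖a j‖ < ∞`. Such a sum has trace `∑ ⟨b j, a j⟩` (`opTrace_eq_tsum`) and trace norm at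
most `∑ ‖b j‖ ‖a j‖` (`traceNorm_le_of_hasSum`).

Part (b). The projections `Π_L` tend strongly to `1`, hence `Π_L F Π_L → F` strongly. The square
root is a uniform limit of polynomials on `[0, 1]`, so the roots converge strongly too
(`tendsto_sqrt_apply`). Normalizing `ρ_L` has no effect after conditioning, so the conditioned state
is `A_L ρ A_L*` divided by a scalar, with contractions `A_L = √F_L Π_L → √F`. The trace-norm
distance is then bounded by sums of `r_j` times norms of vectors tending to zero, and dominated
convergence applies.

Part (a). Birkhoff's theorem on a countable dense subset of `C(X)` gives, for almost every starting
point, weak convergence `μ_N → μ` against all continuous functions. The rest is deterministic for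
such a point. Inner products in `L²(μ_N)` of uniformly convergent continuous functions converge, so
the matrix entries of the data-driven state and effect converge. All matrices act on the fixed space
`ℂ^L`, where conditioning is continuous.

An adapted rotation exists because the samples of `φ_l` are approximate eigenvectors of `K_N`: their
coordinates at eigenvalues far from `λ_l` are small. Discarding those coordinates leaves an almost
orthonormal family, and Gram–Schmidt changes it negligibly without mixing distinct eigenvalue
windows (`eventually_exists_rotation`). A diagonal choice sends the tolerance to zero. The closeness
in `L²(μ_N)` becomes uniform closeness because `K_N` maps `L²` boundedly into `C(X)`
(`tendsto_rotRep`). -/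

set_option linter.unusedSectionVars false

noncomputable section

namespace QMDA

/-! ### Traces and trace norms of nuclear sums -/

section NuclearSums

open InnerProductSpace

variable {H : Type*} [NormedAddCommGroup H] [InnerProductSpace ℂ H]

/-- Cauchy–Schwarz over `s`, then Bessel in each factor. -/
theorem sum_norm_inner_mul_norm_inner_le {ι : Type*} {v : ι → H} (hv : Orthonormal ℂ v)
    (s : Finset ι) (a b : H) :
    ∑ i ∈ s, ‖inner ℂ b (v i)‖ * ‖inner ℂ (v i) a‖ ≤ ‖b‖ * ‖a‖ := by
  refine (Real.sum_mul_le_sqrt_mul_sqrt s _ _).trans ?_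
  have h1 : √(∑ i ∈ s, ‖inner ℂ b (v i)‖ ^ 2) ≤ ‖b‖ := by
    rw [Real.sqrt_le_left (norm_nonneg _)]
    simpa only [norm_inner_symm b] using hv.sum_inner_products_le b (s := s)
  have h2 : √(∑ i ∈ s, ‖inner ℂ (v i) a‖ ^ 2) ≤ ‖a‖ := by
    rw [Real.sqrt_le_left (norm_nonneg _)]
    exact hv.sum_inner_products_le a
  exact mul_le_mul h1 h2 (Real.sqrt_nonneg _) (norm_nonneg _)

theorem hasSum_inner_apply_of_hasSum_rankOne {J : Type*} {T : H →L[ℂ] H} {a b : J → H}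
    (hT : HasSum (fun j => rankOne ℂ (a j) (b j)) T) (v w : H) :
    HasSum (fun j => inner ℂ (b j) v * inner ℂ w (a j)) (inner ℂ w (T v)) := by
  have h1 := (ContinuousLinearMap.apply ℂ H v).hasSum hT
  have h2 := (innerSL ℂ w).hasSum h1
  simpa [inner_smul_right] using h2

theorem hasSum_rankOne_mul_mul [CompleteSpace H] {J : Type*} {T : H →L[ℂ] H} {a b : J → H}
    (hT : HasSum (fun j => rankOne ℂ (a j) (b j)) T) (A B : H →L[ℂ] H) :
    HasSum (fun j => rankOne ℂ (A (a j)) (ContinuousLinearMap.adjoint B (b j))) (A * T * B) := by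
  have h1 := (hT.mul_left A).mul_right B
  have h2 : ∀ j, A * rankOne ℂ (a j) (b j) * B
      = rankOne ℂ (A (a j)) (ContinuousLinearMap.adjoint B (b j)) := fun j => by
    ext x
    simp [ContinuousLinearMap.adjoint_inner_left]
  simpa only [h2] using h1

variable [CompleteSpace H]

theorem exists_hilbertBasis_refBasis (H : Type*) [NormedAddCommGroup H] [InnerProductSpace ℂ H]
    [CompleteSpace H] : ∃ b : HilbertBasis (refBasis H) ℂ H, ∀ v : refBasis H, b v = (v : H) := by
  obtain ⟨b, hb⟩ := refBasis_spec H
  exact ⟨b, fun v => by rw [hb]⟩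

/-- The double family over `j` and the reference basis is absolutely summable, so the sums may be
exchanged; the sum over the basis is then Parseval's identity. This frees the trace from the
reference basis. -/
theorem opTrace_eq_tsum {J : Type*} {T : H →L[ℂ] H} {a b : J → H}
    (hT : HasSum (fun j => rankOne ℂ (a j) (b j)) T)
    (hs : Summable fun j => ‖b j‖ * ‖a j‖) :
    opTrace T = ∑' j, inner ℂ (b j) (a j) := by
  obtain ⟨e, he⟩ := exists_hilbertBasis_refBasis H
  have hB : ∀ j, Summable fun v : refBasis H => ‖inner ℂ (b j) (e v)‖ * ‖inner ℂ (e v) (a j)‖ :=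
    fun j => summable_of_sum_le (fun _ => by positivity)
      fun s => sum_norm_inner_mul_norm_inner_le e.orthonormal s (a j) (b j)
  have hsum : Summable fun p : J × refBasis H =>
      inner ℂ (b p.1) (e p.2) * inner ℂ (e p.2) (a p.1) := by
    apply Summable.of_norm
    simp only [norm_mul]
    rw [summable_prod_of_nonneg (fun _ => by positivity)]
    refine ⟨hB, Summable.of_nonneg_of_le (fun j => tsum_nonneg fun _ => by positivity)
      (fun j => ?_) hs⟩
    exact (hB j).tsum_le_of_sum_le
      fun s => sum_norm_inner_mul_norm_inner_le e.orthonormal s (a j) (b j)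
  unfold opTrace
  calc ∑' v : refBasis H, inner ℂ (v : H) (T v)
      = ∑' v : refBasis H, ∑' j, inner ℂ (b j) (e v) * inner ℂ (e v) (a j) := by
        refine tsum_congr fun v => ?_
        rw [← he v]
        exact (hasSum_inner_apply_of_hasSum_rankOne hT _ _).tsum_eq.symm
    _ = ∑' j, ∑' v : refBasis H, inner ℂ (b j) (e v) * inner ℂ (e v) (a j) :=
        hsum.tsum_comm (f := fun j v => inner ℂ (b j) (e v) * inner ℂ (e v) (a j))
    _ = ∑' j, inner ℂ (b j) (a j) :=
        tsum_congr fun j => (e.hasSum_inner_mul_inner _ _).tsum_eq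

/-- An approximate polar decomposition, with `W = (|T| + ε)⁻¹ T*`. By functional calculus `W W*` is
`t² / (t + ε)² ≤ 1` and `|T| - W T` is `t ε / (t + ε) ≤ ε`, evaluated at `|T|`. -/
theorem exists_abs_eq_contraction_mul_add (T : H →L[ℂ] H) {ε : ℝ} (hε : 0 < ε) :
    ∃ W D : H →L[ℂ] H, CFC.abs T = W * T + D ∧ ‖W‖ ≤ 1 ∧ ‖D‖ ≤ ε := by
  set A := CFC.abs T with hA
  have hA0 : 0 ≤ A := CFC.abs_nonneg T
  have hAsa : IsSelfAdjoint A := hA0.isSelfAdjoint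
  have hspec : ∀ t ∈ spectrum ℝ A, 0 ≤ t := fun t ht => spectrum_nonneg_of_nonneg hA0 ht
  have hAA : A * A = star T * T := CFC.abs_mul_abs T
  have hcont : ContinuousOn (fun t : ℝ => (|t| + ε)⁻¹) (spectrum ℝ A) := by
    apply Continuous.continuousOn
    exact (by fun_prop : Continuous fun t : ℝ => |t| + ε).inv₀ fun t => by positivity
  set R := cfc (fun t : ℝ => (|t| + ε)⁻¹) A with hR
  have hRsa : star R = R := (cfc_predicate _ A : IsSelfAdjoint R)
  have hAid : cfc (fun t : ℝ => t) A = A := cfc_id' ℝ A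
  have hRAA : R * (A * A) = cfc (fun t : ℝ => (|t| + ε)⁻¹ * (t * t)) A := by
    rw [cfc_mul (fun t : ℝ => (|t| + ε)⁻¹) (fun t => t * t) A hcont,
      cfc_mul (fun t : ℝ => t) (fun t => t) A, hAid]
  refine ⟨R * star T, A - R * star T * T, by abel, ?_, ?_⟩
  · have h1 : (R * star T) * star (R * star T)
        = cfc (fun t : ℝ => (|t| + ε)⁻¹ * (t * t) * (|t| + ε)⁻¹) A := by
      rw [cfc_mul (fun t : ℝ => (|t| + ε)⁻¹ * (t * t)) (fun t => (|t| + ε)⁻¹) A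
        (hcont.mul (by fun_prop)) hcont, ← hRAA, star_mul, star_star, hRsa, hAA]
      simp only [mul_assoc, hR]
    have h2 : ‖(R * star T) * star (R * star T)‖ ≤ 1 := by
      rw [h1]
      refine norm_cfc_le zero_le_one fun t ht => ?_
      have ht0 := hspec t ht
      rw [abs_of_nonneg ht0, Real.norm_of_nonneg (by positivity)]
      have : 0 < t + ε := by positivity
      field_simp
      nlinarith
    rw [CStarRing.norm_self_mul_star] at h2
    nlinarith [norm_nonneg (R * star T)]
  · have h1 : A - R * star T * T = cfc (fun t : ℝ => t - (|t| + ε)⁻¹ * (t * t)) A := by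
      rw [cfc_sub (fun t : ℝ => t) (fun t => (|t| + ε)⁻¹ * (t * t)) A (by fun_prop)
        (hcont.mul (by fun_prop)), hAid, ← hRAA, hAA, mul_assoc]
    rw [h1]
    refine norm_cfc_le hε.le fun t ht => ?_
    have ht0 := hspec t ht
    rw [abs_of_nonneg ht0]
    have hpos : 0 < t + ε := by positivity
    have : t - (t + ε)⁻¹ * (t * t) = t * ε / (t + ε) := by field_simp; ring
    rw [this, Real.norm_of_nonneg (by positivity), div_le_iff₀ hpos]
    nlinarith

/-- Up to a small error `|T|` is `W T` with `W` a contraction, and `W T` inherits the rank-one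
decomposition with `a j` replaced by the no longer `W (a j)`. Each finite partial sum of the trace
is then controlled by the Bessel estimate. -/
theorem traceNorm_le_of_hasSum {J : Type*} {T : H →L[ℂ] H} {a b : J → H}
    (hT : HasSum (fun j => rankOne ℂ (a j) (b j)) T)
    (hs : Summable fun j => ‖b j‖ * ‖a j‖) :
    traceNorm T ≤ ENNReal.ofReal (∑' j, ‖b j‖ * ‖a j‖) := by
  obtain ⟨e, he⟩ := exists_hilbertBasis_refBasis H
  unfold traceNorm
  rw [ENNReal.tsum_eq_iSup_sum]
  refine iSup_le fun s => ?_
  have hpos : ∀ v : H, 0 ≤ (inner ℂ v (CFC.abs T v)).re := fun v =>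
    ((ContinuousLinearMap.nonneg_iff_isPositive _).1 (CFC.abs_nonneg T)).re_inner_nonneg_right v
  rw [← ENNReal.ofReal_sum_of_nonneg
    (f := fun v : refBasis H => (inner ℂ (v : H) (CFC.abs T v)).re) fun v _ => hpos v]
  refine ENNReal.ofReal_le_ofReal (le_of_forall_pos_le_add fun δ hδ => ?_)
  -- The error is spent once for each vector of `s`, hence at most `δ` in total; the `+ 1` covers
  -- the empty `s`.
  obtain ⟨W, D, hWD, hW, hD⟩ := exists_abs_eq_contraction_mul_add T
    (ε := δ / (s.card + 1)) (by positivity)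
  have key : ∀ v ∈ s, (inner ℂ (v : H) (CFC.abs T v)).re ≤
      ∑' j, ‖inner ℂ (b j) (e v)‖ * ‖inner ℂ (e v) (W (a j))‖ + δ / (s.card + 1) := by
    intro v _
    rw [← he v, hWD, add_apply, inner_add_right, Complex.add_re]
    refine add_le_add ?_ ?_
    · have h1 : HasSum (fun j => inner ℂ (b j) (e v) * inner ℂ (e v) (W (a j)))
          (inner ℂ (e v) ((W * T) (e v))) := by
        have h := hasSum_inner_apply_of_hasSum_rankOne
          (hasSum_rankOne_mul_mul hT W 1) (e v) (e v)
        simp only [ContinuousLinearMap.adjoint_inner_left, one_apply_eq_self,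
          mul_one] at h
        exact h
      have h2 : Summable fun j => ‖inner ℂ (b j) (e v) * inner ℂ (e v) (W (a j))‖ := h1.summable.norm
      rw [← h1.tsum_eq]
      refine (Complex.re_le_norm _).trans ((norm_tsum_le_tsum_norm h2).trans_eq ?_)
      simp only [norm_mul]
    · refine (Complex.re_le_norm _).trans ((norm_inner_le_norm _ _).trans ?_)
      have := D.le_opNorm (e v)
      rw [e.orthonormal.norm_eq_one, mul_one] at this
      rw [e.orthonormal.norm_eq_one, one_mul]
      exact this.trans hD
  have hsumv : ∀ v ∈ s, Summable fun j => ‖inner ℂ (b j) (e v)‖ * ‖inner ℂ (e v) (W (a j))‖ := by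
    intro v _
    refine Summable.of_nonneg_of_le (fun _ => by positivity) (fun j => ?_) hs
    have h1 := norm_inner_le_norm (𝕜 := ℂ) (b j) (e v)
    have h2 := norm_inner_le_norm (𝕜 := ℂ) (e v) (W (a j))
    rw [e.orthonormal.norm_eq_one, mul_one] at h1
    rw [e.orthonormal.norm_eq_one, one_mul] at h2
    have h3 : ‖W (a j)‖ ≤ ‖a j‖ := (W.le_of_opNorm_le hW _).trans_eq (one_mul _)
    exact mul_le_mul h1 (h2.trans h3) (norm_nonneg _) (norm_nonneg _)
  calc ∑ v ∈ s, (inner ℂ (v : H) (CFC.abs T v)).re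
      ≤ ∑ v ∈ s, (∑' j, ‖inner ℂ (b j) (e v)‖ * ‖inner ℂ (e v) (W (a j))‖ + δ / (s.card + 1)) :=
        Finset.sum_le_sum key
    _ = ∑' j, ∑ v ∈ s, ‖inner ℂ (b j) (e v)‖ * ‖inner ℂ (e v) (W (a j))‖
          + s.card * (δ / (s.card + 1)) := by
        rw [Finset.sum_add_distrib, Summable.tsum_finsetSum hsumv]
        simp
    _ ≤ ∑' j, ‖b j‖ * ‖a j‖ + δ := by
        refine add_le_add ?_ ?_
        · refine Summable.tsum_le_tsum (fun j => ?_) (summable_sum hsumv) hs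
          refine (sum_norm_inner_mul_norm_inner_le e.orthonormal s _ _).trans ?_
          exact mul_le_mul_of_nonneg_left ((W.le_of_opNorm_le hW _).trans_eq (one_mul _))
            (norm_nonneg _)
        · rw [mul_div_assoc', div_le_iff₀ (by positivity)]
          nlinarith

end NuclearSums

/-! ### Strong and norm continuity of the square root on effects -/

section StrongConvergence

variable {H : Type*} [NormedAddCommGroup H] [InnerProductSpace ℂ H] [CompleteSpace H]

theorem spectrum_subset_Icc_of_nonneg_of_le_one {A : H →L[ℂ] H} (h0 : 0 ≤ A) (h1 : A ≤ 1) :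
    spectrum ℝ A ⊆ Set.Icc 0 1 := by
  intro t ht
  refine ⟨spectrum_nonneg_of_nonneg h0 ht, ?_⟩
  have h : A ≤ algebraMap ℝ (H →L[ℂ] H) 1 := by simpa using h1
  exact (le_algebraMap_iff_spectrum_le h0.isSelfAdjoint).1 h t ht

theorem sqrt_eq_cfc_real_sqrt {A : H →L[ℂ] H} (h0 : 0 ≤ A) :
    CFC.sqrt A = cfc Real.sqrt A := by
  rw [CFC.sqrt_eq_real_sqrt A h0, cfcₙ_eq_cfc]

theorem norm_le_one_of_nonneg_of_le_one {A : H →L[ℂ] H} (h0 : 0 ≤ A) (h1 : A ≤ 1) :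
    ‖A‖ ≤ 1 := by
  rw [← cfc_id' ℝ A h0.isSelfAdjoint]
  refine norm_cfc_le zero_le_one fun t ht => ?_
  have := spectrum_subset_Icc_of_nonneg_of_le_one h0 h1 ht
  rw [Real.norm_of_nonneg this.1]
  exact this.2

theorem norm_sqrt_le_one {A : H →L[ℂ] H} (h0 : 0 ≤ A) (h1 : A ≤ 1) : ‖CFC.sqrt A‖ ≤ 1 := by
  rw [sqrt_eq_cfc_real_sqrt h0]
  refine norm_cfc_le zero_le_one fun t ht => ?_
  have := spectrum_subset_Icc_of_nonneg_of_le_one h0 h1 ht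
  rw [Real.norm_of_nonneg (Real.sqrt_nonneg _)]
  exact Real.sqrt_le_one.2 this.2

omit [CompleteSpace H] in
-- Split as `A i (B i v - B' v) + (A i - A') (B' v)`; the uniform bound on `A i` is what controls
-- the first term.
theorem tendsto_mul_apply {ι : Type*} {l : Filter ι} {A B : ι → H →L[ℂ] H} {A' B' : H →L[ℂ] H}
    (hA1 : ∀ i, ‖A i‖ ≤ 1)
    (hA : ∀ v, Tendsto (fun i => A i v) l (𝓝 (A' v)))
    (hB : ∀ v, Tendsto (fun i => B i v) l (𝓝 (B' v))) (v : H) :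
    Tendsto (fun i => (A i * B i) v) l (𝓝 ((A' * B') v)) := by
  have h1 : Tendsto (fun i => A i (B i v - B' v)) l (𝓝 0) := by
    refine squeeze_zero_norm (fun i => ?_)
      (tendsto_zero_iff_norm_tendsto_zero.1 (tendsto_sub_nhds_zero_iff.2 (hB v)))
    exact ((A i).le_of_opNorm_le (hA1 i) _).trans_eq (one_mul _)
  simpa [ContinuousLinearMap.mul_apply'] using h1.add (hA (B' v))

omit [CompleteSpace H] in
theorem tendsto_aeval_apply {ι : Type*} {l : Filter ι} {A : ι → H →L[ℂ] H} {A' : H →L[ℂ] H}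
    (hA1 : ∀ i, ‖A i‖ ≤ 1)
    (hA : ∀ v, Tendsto (fun i => A i v) l (𝓝 (A' v))) (p : Polynomial ℝ) :
    ∀ v, Tendsto (fun i => Polynomial.aeval (A i) p v) l (𝓝 (Polynomial.aeval A' p v)) := by
  induction p using Polynomial.induction_on' with
  | add p q hp hq =>
    intro v
    simpa using (hp v).add (hq v)
  | monomial n c =>
    have hpow : ∀ v, Tendsto (fun i => (A i ^ n) v) l (𝓝 ((A' ^ n) v)) := by
      induction n with
      | zero => intro v; simpa using tendsto_const_nhds
      | succ n ih =>
        intro v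
        simp only [pow_succ']
        exact tendsto_mul_apply hA1 hA ih v
    intro v
    simp only [Polynomial.aeval_monomial, ← Algebra.smul_def]
    exact (hpow v).const_smul c

theorem exists_polynomial_sqrt_near {ε : ℝ} (hε : 0 < ε) :
    ∃ p : Polynomial ℝ, ∀ t ∈ Set.Icc (0 : ℝ) 1, |p.eval t - √t| < ε :=
  exists_polynomial_near_of_continuousOn 0 1 _ (Real.continuous_sqrt.continuousOn) ε hε

/-- Polynomials are strongly continuous on contractions, and one polynomial approximates the square
root on `[0, 1]`, which contains all the spectra, uniformly in `i`. -/
theorem tendsto_sqrt_apply {ι : Type*} {l : Filter ι} {A : ι → H →L[ℂ] H} {A' : H →L[ℂ] H}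
    (hA0 : ∀ i, 0 ≤ A i) (hA1 : ∀ i, A i ≤ 1) (hA0' : 0 ≤ A') (hA1' : A' ≤ 1)
    (hA : ∀ v, Tendsto (fun i => A i v) l (𝓝 (A' v))) (v : H) :
    Tendsto (fun i => CFC.sqrt (A i) v) l (𝓝 (CFC.sqrt A' v)) := by
  rw [Metric.tendsto_nhds]
  intro ε hε
  -- Chosen so that `δ ‖v‖ ≤ ε / 3`; the `+ 1` allows `v = 0`.
  set δ := ε / (3 * (‖v‖ + 1)) with hδ
  have hδ0 : 0 < δ := by positivity
  obtain ⟨p, hp⟩ := exists_polynomial_sqrt_near hδ0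
  have hclose : ∀ B : H →L[ℂ] H, 0 ≤ B → B ≤ 1 →
      dist (CFC.sqrt B v) (Polynomial.aeval B p v) ≤ ε / 3 := by
    intro B h0 h1
    have hB : ‖CFC.sqrt B - Polynomial.aeval B p‖ ≤ δ := by
      rw [sqrt_eq_cfc_real_sqrt h0, ← cfc_polynomial p B h0.isSelfAdjoint,
        ← cfc_sub _ _ B (by fun_prop) (by fun_prop)]
      refine norm_cfc_le hδ0.le fun t ht => ?_
      rw [Real.norm_eq_abs, abs_sub_comm]
      exact (hp t (spectrum_subset_Icc_of_nonneg_of_le_one h0 h1 ht)).le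
    rw [dist_eq_norm, ← sub_apply]
    refine (ContinuousLinearMap.le_of_opNorm_le _ hB v).trans ?_
    rw [hδ, div_mul_eq_mul_div, div_le_div_iff₀ (by positivity) (by positivity)]
    nlinarith [norm_nonneg v]
  have hev := (Metric.tendsto_nhds.1 (tendsto_aeval_apply
    (fun i => norm_le_one_of_nonneg_of_le_one (hA0 i) (hA1 i)) hA p v)) (ε / 3) (by positivity)
  filter_upwards [hev] with i hi
  have h1 := hclose _ (hA0 i) (hA1 i)
  have h2 := hclose _ hA0' hA1'
  rw [dist_comm] at h2
  have h3 := dist_triangle4 (CFC.sqrt (A i) v) (Polynomial.aeval (A i) p v)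
    (Polynomial.aeval A' p v) (CFC.sqrt A' v)
  linarith

theorem tendsto_sqrt_of_tendsto {ι : Type*} {l : Filter ι} {A : ι → H →L[ℂ] H} {A' : H →L[ℂ] H}
    (hA0 : ∀ᶠ i in l, 0 ≤ A i) (hA1 : ∀ᶠ i in l, A i ≤ 1) (hA0' : 0 ≤ A') (hA1' : A' ≤ 1)
    (hA : Tendsto A l (𝓝 A')) :
    Tendsto (fun i => CFC.sqrt (A i)) l (𝓝 (CFC.sqrt A')) := by
  rw [sqrt_eq_cfc_real_sqrt hA0']
  have h := hA.cfc (s := Set.Icc (0 : ℝ) 1) isCompact_Icc Real.sqrt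
    (by filter_upwards [hA0, hA1] with i h0 h1 using
      spectrum_subset_Icc_of_nonneg_of_le_one h0 h1)
    (by filter_upwards [hA0] with i h0 using h0.isSelfAdjoint)
    (spectrum_subset_Icc_of_nonneg_of_le_one hA0' hA1') hA0'.isSelfAdjoint
  refine h.congr' ?_
  filter_upwards [hA0] with i h0 using (sqrt_eq_cfc_real_sqrt h0).symm

end StrongConvergence

/-! ### Compressions as operators on the fixed space `ℂ^L` -/

section Compression

open InnerProductSpace ContinuousLinearMap

variable {H : Type*} [NormedAddCommGroup H] [InnerProductSpace ℂ H] [CompleteSpace H]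

/-- The operator from `ℂ^L` to `H` that maps the standard basis to `φ 0, …, φ (L - 1)`. -/
def embed (φ : ℕ → H) (L : ℕ) : EuclideanSpace ℂ (Fin L) →L[ℂ] H :=
  ∑ i : Fin L, rankOne ℂ (φ i) (EuclideanSpace.basisFun (Fin L) ℂ i)

/-- The operator `V* A V` on `ℂ^L`, where `V` is the embedding of `ℂ^L` given by
`φ 0, …, φ (L - 1)`. -/
def reduced (φ : ℕ → H) (L : ℕ) (A : H →L[ℂ] H) :
    EuclideanSpace ℂ (Fin L) →L[ℂ] EuclideanSpace ℂ (Fin L) :=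
  adjoint (embed φ L) ∘L A ∘L embed φ L

/-- The trace of an operator on `ℂ^L`. -/
def finTrace {L : ℕ} (B : EuclideanSpace ℂ (Fin L) →L[ℂ] EuclideanSpace ℂ (Fin L)) : ℂ :=
  ∑ i, inner ℂ (EuclideanSpace.basisFun (Fin L) ℂ i) (B (EuclideanSpace.basisFun (Fin L) ℂ i))

omit [CompleteSpace H] in
theorem embed_basisFun (φ : ℕ → H) (L : ℕ) (i : Fin L) :
    embed φ L (EuclideanSpace.basisFun (Fin L) ℂ i) = φ i := by
  simp only [embed, sum_apply, rankOne_apply,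
    orthonormal_iff_ite.1 (EuclideanSpace.basisFun (Fin L) ℂ).orthonormal]
  simp

theorem adjoint_embed (φ : ℕ → H) (L : ℕ) :
    adjoint (embed φ L) = ∑ i : Fin L, rankOne ℂ (EuclideanSpace.basisFun (Fin L) ℂ i) (φ i) := by
  simp [embed, map_sum]

theorem inner_basisFun_reduced (φ : ℕ → H) (L : ℕ) (A : H →L[ℂ] H) (i j : Fin L) :
    inner ℂ (EuclideanSpace.basisFun (Fin L) ℂ i)
      (reduced φ L A (EuclideanSpace.basisFun (Fin L) ℂ j)) = inner ℂ (φ i) (A (φ j)) := by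
  simp only [reduced, ContinuousLinearMap.coe_comp, Function.comp_apply, adjoint_inner_right, embed_basisFun]

theorem adjoint_embed_comp_embed {φ : ℕ → H} {L : ℕ} (hφ : Orthonormal ℂ fun i : Fin L => φ i) :
    adjoint (embed φ L) ∘L embed φ L = 1 := by
  apply ContinuousLinearMap.coe_injective
  refine (EuclideanSpace.basisFun (Fin L) ℂ).toBasis.ext fun j => ?_
  simp only [OrthonormalBasis.coe_toBasis, coe_coe, ContinuousLinearMap.coe_comp, Function.comp_apply, embed_basisFun,
    adjoint_embed, sum_apply, rankOne_apply, orthonormal_iff_ite.1 hφ, one_apply_eq_self]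
  simp

theorem embed_comp_adjoint_embed {φ : ℕ → H} {L : ℕ} (hφ : Orthonormal ℂ fun i : Fin L => φ i) :
    embed φ L ∘L adjoint (embed φ L) = (leadingSpan φ L).starProjection := by
  ext x
  have hx : (embed φ L ∘L adjoint (embed φ L)) x = ∑ i : Fin L, inner ℂ (φ i) x • φ i := by
    simp only [ContinuousLinearMap.coe_comp, Function.comp_apply, adjoint_embed, sum_apply, rankOne_apply, map_sum,
      map_smul, embed_basisFun]
  rw [hx]
  symm
  apply Submodule.eq_starProjection_of_mem_of_inner_eq_zero
  · exact Submodule.sum_mem _ fun i _ =>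
      Submodule.smul_mem _ _ (Submodule.subset_span (Set.mem_range_self i))
  · intro w hw
    induction hw using Submodule.span_induction with
    | mem w hw =>
      obtain ⟨j, rfl⟩ := hw
      simp only [inner_sub_left, sum_inner, inner_smul_left, orthonormal_iff_ite.1 hφ]
      simp
    | zero => simp
    | add u v _ _ hu hv => rw [inner_add_right, hu, hv, add_zero]
    | smul c u _ hu => rw [inner_smul_right, hu, mul_zero]

/-- With `V` the embedding, `V V*` is the projection onto the span. Compressions on different
Hilbert spaces thereby become comparable through their reduced operators on `ℂ^L`. -/
theorem compress_eq {φ : ℕ → H} {L : ℕ} (hφ : Orthonormal ℂ fun i : Fin L => φ i)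
    (A : H →L[ℂ] H) :
    compress φ L A = embed φ L ∘L reduced φ L A ∘L adjoint (embed φ L) := by
  rw [compress, ← embed_comp_adjoint_embed hφ]
  rfl

theorem conj_embed_mul {φ : ℕ → H} {L : ℕ} (hφ : Orthonormal ℂ fun i : Fin L => φ i)
    (A B : EuclideanSpace ℂ (Fin L) →L[ℂ] EuclideanSpace ℂ (Fin L)) :
    (embed φ L ∘L A ∘L adjoint (embed φ L)) * (embed φ L ∘L B ∘L adjoint (embed φ L))
      = embed φ L ∘L (A * B) ∘L adjoint (embed φ L) := by
  ext x
  have h : ∀ w, adjoint (embed φ L) (embed φ L w) = w := fun w =>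
    DFunLike.congr_fun (adjoint_embed_comp_embed hφ) w
  simp [h]

theorem conj_embed_nonneg (φ : ℕ → H) {L : ℕ}
    {A : EuclideanSpace ℂ (Fin L) →L[ℂ] EuclideanSpace ℂ (Fin L)} (hA : 0 ≤ A) :
    0 ≤ embed φ L ∘L A ∘L adjoint (embed φ L) := by
  rw [nonneg_iff_isPositive] at hA ⊢
  exact hA.conj_adjoint _

theorem reduced_nonneg (φ : ℕ → H) (L : ℕ) {A : H →L[ℂ] H} (hA : 0 ≤ A) :
    0 ≤ reduced φ L A := by
  rw [nonneg_iff_isPositive] at hA ⊢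
  exact hA.adjoint_conj _

theorem reduced_le_one {φ : ℕ → H} {L : ℕ} (hφ : Orthonormal ℂ fun i : Fin L => φ i)
    {A : H →L[ℂ] H} (hA : A ≤ 1) : reduced φ L A ≤ 1 := by
  rw [← sub_nonneg]
  have h : 1 - reduced φ L A = reduced φ L (1 - A) := by
    rw [← adjoint_embed_comp_embed hφ]
    ext x
    simp [reduced]
  rw [h]
  exact reduced_nonneg φ L (sub_nonneg.2 hA)

/-- Because `V* V = 1`, the map `A ↦ V A V*` is multiplicative and preserves positivity, so the
claim is uniqueness of the positive square root. -/
theorem sqrt_conj_embed {φ : ℕ → H} {L : ℕ} (hφ : Orthonormal ℂ fun i : Fin L => φ i)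
    {A : EuclideanSpace ℂ (Fin L) →L[ℂ] EuclideanSpace ℂ (Fin L)} (hA : 0 ≤ A) :
    CFC.sqrt (embed φ L ∘L A ∘L adjoint (embed φ L))
      = embed φ L ∘L CFC.sqrt A ∘L adjoint (embed φ L) := by
  refine CFC.sqrt_unique ?_ (conj_embed_nonneg φ (CFC.sqrt_nonneg A))
  rw [conj_embed_mul hφ, CFC.sqrt_mul_sqrt_self A hA]

theorem opTrace_conj_embed {φ : ℕ → H} {L : ℕ} (hφ : Orthonormal ℂ fun i : Fin L => φ i)
    (A : EuclideanSpace ℂ (Fin L) →L[ℂ] EuclideanSpace ℂ (Fin L)) :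
    opTrace (embed φ L ∘L A ∘L adjoint (embed φ L)) = finTrace A := by
  have hT : HasSum (fun i : Fin L =>
      rankOne ℂ (embed φ L (A (EuclideanSpace.basisFun (Fin L) ℂ i))) (φ i))
      (embed φ L ∘L A ∘L adjoint (embed φ L)) := by
    have h : embed φ L ∘L A ∘L adjoint (embed φ L) = ∑ i : Fin L,
        rankOne ℂ (embed φ L (A (EuclideanSpace.basisFun (Fin L) ℂ i))) (φ i) := by
      ext x
      simp [adjoint_embed, -EuclideanSpace.basisFun_apply]
    rw [h]
    exact hasSum_fintype _
  rw [opTrace_eq_tsum hT (hasSum_fintype _).summable, tsum_fintype]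
  refine Finset.sum_congr rfl fun i _ => ?_
  nth_rw 1 [← embed_basisFun φ L i]
  rw [← adjoint_inner_right]
  exact congrArg _ (DFunLike.congr_fun (adjoint_embed_comp_embed hφ) _)

theorem inner_conj_embed {φ : ℕ → H} {L : ℕ} (hφ : Orthonormal ℂ fun i : Fin L => φ i)
    (A : EuclideanSpace ℂ (Fin L) →L[ℂ] EuclideanSpace ℂ (Fin L)) (i j : Fin L) :
    inner ℂ (φ i) ((embed φ L ∘L A ∘L adjoint (embed φ L)) (φ j))
      = inner ℂ (EuclideanSpace.basisFun (Fin L) ℂ i)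
          (A (EuclideanSpace.basisFun (Fin L) ℂ j)) := by
  have h : ∀ w, adjoint (embed φ L) (embed φ L w) = w := fun w =>
    DFunLike.congr_fun (adjoint_embed_comp_embed hφ) w
  rw [← embed_basisFun φ L i, ← embed_basisFun φ L j, ← adjoint_inner_right]
  simp [h, -EuclideanSpace.basisFun_apply]

theorem opTrace_compress {φ : ℕ → H} {L : ℕ} (hφ : Orthonormal ℂ fun i : Fin L => φ i)
    (A : H →L[ℂ] H) : opTrace (compress φ L A) = finTrace (reduced φ L A) := by
  rw [compress_eq hφ, opTrace_conj_embed hφ]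

theorem normalize_compress {φ : ℕ → H} {L : ℕ} (hφ : Orthonormal ℂ fun i : Fin L => φ i)
    (A : H →L[ℂ] H) :
    normalize (compress φ L A) = embed φ L ∘L
      ((finTrace (reduced φ L A))⁻¹ • reduced φ L A) ∘L adjoint (embed φ L) := by
  rw [normalize, opTrace_compress hφ, compress_eq hφ]
  ext x
  simp

theorem validity_normalize_compress {φ : ℕ → H} {L : ℕ}
    (hφ : Orthonormal ℂ fun i : Fin L => φ i) (A F : H →L[ℂ] H) :
    validity (normalize (compress φ L A)) (compress φ L F)
      = finTrace (((finTrace (reduced φ L A))⁻¹ • reduced φ L A) * reduced φ L F) := by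
  rw [validity, normalize_compress hφ, compress_eq hφ F, conj_embed_mul hφ,
    opTrace_conj_embed hφ]

theorem matrixRep_condition_compress {φ : ℕ → H} {L : ℕ}
    (hφ : Orthonormal ℂ fun i : Fin L => φ i) (A : H →L[ℂ] H) {F : H →L[ℂ] H} (hF : 0 ≤ F) :
    matrixRep φ L (condition (normalize (compress φ L A)) (compress φ L F))
      = Matrix.of fun i j => (validity (normalize (compress φ L A)) (compress φ L F))⁻¹ *
          inner ℂ (EuclideanSpace.basisFun (Fin L) ℂ i)
            ((CFC.sqrt (reduced φ L F) * ((finTrace (reduced φ L A))⁻¹ • reduced φ L A) *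
              CFC.sqrt (reduced φ L F)) (EuclideanSpace.basisFun (Fin L) ℂ j)) := by
  ext i j
  rw [matrixRep, Matrix.of_apply, Matrix.of_apply, condition, smul_apply,
    inner_smul_right]
  congr 1
  rw [normalize_compress hφ, compress_eq hφ F, sqrt_conj_embed hφ (reduced_nonneg φ L hF),
    conj_embed_mul hφ, conj_embed_mul hφ, inner_conj_embed hφ]

theorem eq_sum_entries {L : ℕ}
    (B : EuclideanSpace ℂ (Fin L) →L[ℂ] EuclideanSpace ℂ (Fin L)) :
    B = ∑ i, ∑ j, inner ℂ (EuclideanSpace.basisFun (Fin L) ℂ i)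
      (B (EuclideanSpace.basisFun (Fin L) ℂ j)) •
        rankOne ℂ (EuclideanSpace.basisFun (Fin L) ℂ i) (EuclideanSpace.basisFun (Fin L) ℂ j) := by
  apply ContinuousLinearMap.coe_injective
  refine (EuclideanSpace.basisFun (Fin L) ℂ).toBasis.ext fun k => ?_
  simp only [OrthonormalBasis.coe_toBasis, coe_coe, sum_apply, smul_apply, rankOne_apply,
    orthonormal_iff_ite.1 (EuclideanSpace.basisFun (Fin L) ℂ).orthonormal, ite_smul, one_smul,
    zero_smul, smul_ite, smul_zero, Finset.sum_ite_eq', Finset.mem_univ, if_true]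
  exact ((EuclideanSpace.basisFun (Fin L) ℂ).sum_repr' _).symm

theorem tendsto_of_tendsto_entries {ι : Type*} {l : Filter ι} {L : ℕ}
    {B : ι → EuclideanSpace ℂ (Fin L) →L[ℂ] EuclideanSpace ℂ (Fin L)}
    {B' : EuclideanSpace ℂ (Fin L) →L[ℂ] EuclideanSpace ℂ (Fin L)}
    (h : ∀ i j, Tendsto (fun n => inner ℂ (EuclideanSpace.basisFun (Fin L) ℂ i)
      (B n (EuclideanSpace.basisFun (Fin L) ℂ j))) l
      (𝓝 (inner ℂ (EuclideanSpace.basisFun (Fin L) ℂ i)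
        (B' (EuclideanSpace.basisFun (Fin L) ℂ j))))) :
    Tendsto B l (𝓝 B') := by
  rw [eq_sum_entries B', show B = _ from funext fun n => eq_sum_entries (B n)]
  exact tendsto_finsetSum _ fun i _ => tendsto_finsetSum _ fun j _ => (h i j).smul_const _

theorem continuous_finTrace (L : ℕ) : Continuous (finTrace (L := L)) := by
  unfold finTrace
  fun_prop

/-- Convergence of the matrices of the conditioned compressions, if the matrices of the operators
converge. The Hilbert spaces may vary. -/
theorem tendsto_matrixRep_condition_compress {L : ℕ} {K : ℕ → Type*}
    [∀ n, NormedAddCommGroup (K n)] [∀ n, InnerProductSpace ℂ (K n)] [∀ n, CompleteSpace (K n)]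
    {φ : ℕ → H} (hφ : Orthonormal ℂ fun i : Fin L => φ i)
    {φn : ∀ n, ℕ → K n} (hφn : ∀ᶠ n in atTop, Orthonormal ℂ fun i : Fin L => φn n i)
    {A F : H →L[ℂ] H} (hF0 : 0 ≤ F) (hF1 : F ≤ 1)
    {An Fn : ∀ n, K n →L[ℂ] K n} (hFn0 : ∀ᶠ n in atTop, 0 ≤ Fn n) (hFn1 : ∀ᶠ n in atTop, Fn n ≤ 1)
    (hA : ∀ i j : Fin L, Tendsto (fun n => inner ℂ (φn n i) (An n (φn n j))) atTop
      (𝓝 (inner ℂ (φ i) (A (φ j)))))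
    (hF : ∀ i j : Fin L, Tendsto (fun n => inner ℂ (φn n i) (Fn n (φn n j))) atTop
      (𝓝 (inner ℂ (φ i) (F (φ j)))))
    (hC : opTrace (compress φ L A) ≠ 0)
    (hV : validity (normalize (compress φ L A)) (compress φ L F) ≠ 0) :
    (∀ᶠ n in atTop, opTrace (compress (φn n) L (An n)) ≠ 0 ∧
      validity (normalize (compress (φn n) L (An n))) (compress (φn n) L (Fn n)) ≠ 0) ∧
    Tendsto (fun n => matrixRep (φn n) L
        (condition (normalize (compress (φn n) L (An n))) (compress (φn n) L (Fn n)))) atTop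
      (𝓝 (matrixRep φ L (condition (normalize (compress φ L A)) (compress φ L F)))) := by
  -- In finite dimension, entrywise convergence is norm convergence, so traces, inverses and square
  -- roots all pass to the limit.
  have hR : Tendsto (fun n => reduced (φn n) L (An n)) atTop (𝓝 (reduced φ L A)) :=
    tendsto_of_tendsto_entries fun i j => by simpa only [inner_basisFun_reduced] using hA i j
  have hB : Tendsto (fun n => reduced (φn n) L (Fn n)) atTop (𝓝 (reduced φ L F)) :=
    tendsto_of_tendsto_entries fun i j => by simpa only [inner_basisFun_reduced] using hF i j
  have hS : Tendsto (fun n => CFC.sqrt (reduced (φn n) L (Fn n))) atTop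
      (𝓝 (CFC.sqrt (reduced φ L F))) := by
    refine tendsto_sqrt_of_tendsto ?_ ?_ (reduced_nonneg φ L hF0) (reduced_le_one hφ hF1) hB
    · filter_upwards [hFn0] with n hn using reduced_nonneg _ L hn
    · filter_upwards [hFn1, hφn] with n hn hφn using reduced_le_one hφn hn
  have hT : Tendsto (fun n => finTrace (reduced (φn n) L (An n))) atTop
      (𝓝 (finTrace (reduced φ L A))) := ((continuous_finTrace L).tendsto _).comp hR
  rw [opTrace_compress hφ] at hC
  have hRn : Tendsto (fun n => (finTrace (reduced (φn n) L (An n)))⁻¹ • reduced (φn n) L (An n))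
      atTop (𝓝 ((finTrace (reduced φ L A))⁻¹ • reduced φ L A)) := (hT.inv₀ hC).smul hR
  have hVn : Tendsto (fun n => validity (normalize (compress (φn n) L (An n)))
      (compress (φn n) L (Fn n))) atTop
      (𝓝 (validity (normalize (compress φ L A)) (compress φ L F))) := by
    rw [validity_normalize_compress hφ]
    refine (((continuous_finTrace L).tendsto _).comp (hRn.mul hB)).congr' ?_
    filter_upwards [hφn] with n hn
    rw [validity_normalize_compress hn]
    rfl
  refine ⟨?_, ?_⟩
  · filter_upwards [hφn, hT.eventually_ne hC, hVn.eventually_ne hV] with n hn h1 h2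
    exact ⟨by rwa [opTrace_compress hn], h2⟩
  · rw [matrixRep_condition_compress hφ A hF0]
    refine tendsto_pi_nhds.2 fun i => tendsto_pi_nhds.2 fun j => ?_
    have h1 : Tendsto (fun n => inner ℂ (EuclideanSpace.basisFun (Fin L) ℂ i)
            ((CFC.sqrt (reduced (φn n) L (Fn n)) *
              ((finTrace (reduced (φn n) L (An n)))⁻¹ • reduced (φn n) L (An n)) *
              CFC.sqrt (reduced (φn n) L (Fn n))) (EuclideanSpace.basisFun (Fin L) ℂ j))) atTop
        (𝓝 (inner ℂ (EuclideanSpace.basisFun (Fin L) ℂ i)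
            ((CFC.sqrt (reduced φ L F) * ((finTrace (reduced φ L A))⁻¹ • reduced φ L A) *
              CFC.sqrt (reduced φ L F)) (EuclideanSpace.basisFun (Fin L) ℂ j)))) := by
      have hc : Continuous fun T : EuclideanSpace ℂ (Fin L) →L[ℂ] EuclideanSpace ℂ (Fin L) =>
          inner ℂ (EuclideanSpace.basisFun (Fin L) ℂ i)
            (T (EuclideanSpace.basisFun (Fin L) ℂ j)) := by fun_prop
      exact (hc.tendsto _).comp ((hS.mul hRn).mul hS)
    refine ((hVn.inv₀ hV).mul h1).congr' ?_
    filter_upwards [hφn, hFn0] with n hn h0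
    rw [matrixRep_condition_compress hn (An n) h0]
    rfl

end Compression

/-! ### Birkhoff's pointwise ergodic theorem -/

section Birkhoff

variable {X : Type*} [MeasurableSpace X] {μ : Measure X} [IsProbabilityMeasure μ] {T : X → X}

/-- The maximum of `0` and of the first `n` nonempty Birkhoff sums of `g`. -/
def maxBirkhoffSum (T : X → X) (g : X → ℝ) : ℕ → X → ℝ
  | 0 => fun _ => 0
  | n + 1 => fun x => max 0 (g x + maxBirkhoffSum T g n (T x))

omit [MeasurableSpace X] in
theorem maxBirkhoffSum_nonneg (T : X → X) (g : X → ℝ) (n : ℕ) (x : X) :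
    0 ≤ maxBirkhoffSum T g n x := by
  cases n with
  | zero => exact le_rfl
  | succ n => exact le_max_left _ _

omit [MeasurableSpace X] in
theorem maxBirkhoffSum_mono (T : X → X) (g : X → ℝ) (x : X) :
    Monotone fun n => maxBirkhoffSum T g n x := by
  refine monotone_nat_of_le_succ fun n => ?_
  induction n generalizing x with
  | zero => exact maxBirkhoffSum_nonneg T g 1 x
  | succ n ih => exact max_le_max le_rfl (add_le_add_right (ih (T x)) _)

omit [MeasurableSpace X] in
theorem birkhoffSum_le_maxBirkhoffSum (T : X → X) (g : X → ℝ) (n : ℕ) (x : X) :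
    birkhoffSum T g n x ≤ maxBirkhoffSum T g n x := by
  induction n generalizing x with
  | zero => simp [maxBirkhoffSum]
  | succ n ih =>
    rw [birkhoffSum_succ']
    exact (add_le_add_right (ih (T x)) _).trans (le_max_right _ _)

omit [MeasurableSpace X] in
theorem maxBirkhoffSum_le {g : X → ℝ} {C : ℝ} (hC : ∀ x, |g x| ≤ C) (n : ℕ) (x : X) :
    maxBirkhoffSum T g n x ≤ n * C := by
  induction n generalizing x with
  | zero => simp [maxBirkhoffSum]
  | succ n ih =>
    have h0 : 0 ≤ C := (abs_nonneg _).trans (hC x)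
    have h1 := (le_abs_self _).trans (hC x)
    have h2 := ih (T x)
    refine max_le (by positivity) ?_
    push_cast
    linarith

theorem measurable_maxBirkhoffSum (hT : Measurable T) {g : X → ℝ} (hg : Measurable g) (n : ℕ) :
    Measurable (maxBirkhoffSum T g n) := by
  induction n with
  | zero => exact measurable_const
  | succ n ih => exact measurable_const.max (hg.add (ih.comp hT))

theorem integrable_maxBirkhoffSum (hT : Measurable T) {g : X → ℝ} (hg : Measurable g) {C : ℝ}
    (hC : ∀ x, |g x| ≤ C) (n : ℕ) : Integrable (maxBirkhoffSum T g n) μ :=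
  Integrable.of_bound (measurable_maxBirkhoffSum hT hg n).aestronglyMeasurable (n * C)
    (Eventually.of_forall fun x => by
      rw [Real.norm_of_nonneg (maxBirkhoffSum_nonneg T g n x)]
      exact maxBirkhoffSum_le hC n x)

/-- A form of the maximal ergodic theorem. -/
theorem ae_bddAbove_maxBirkhoffSum (hT : Ergodic T μ) {g : X → ℝ} (hg : Measurable g) {C : ℝ}
    (hC : ∀ x, |g x| ≤ C) (hneg : ∫ x, g x ∂μ < 0) :
    ∀ᵐ x ∂μ, BddAbove (Set.range fun n => maxBirkhoffSum T g n x) := by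
  have hTm := hT.measurable
  set S : Set X := {x | BddAbove (Set.range fun n => maxBirkhoffSum T g n x)} with hS
  have hSm : MeasurableSet S :=
    measurableSet_bddAbove_range fun n => measurable_maxBirkhoffSum hTm hg n
  -- From `M (n + 1) x = max 0 (g x + M n (T x))`, boundedness at `x` and at `T x` are equivalent;
  -- ergodicity then makes `S` null or conull.
  have hinv : T ⁻¹' S = S := by
    ext x
    simp only [hS, Set.mem_preimage, Set.mem_ofPred_eq, bddAbove_def, Set.forall_mem_range]
    constructor
    · rintro ⟨c, hc⟩
      refine ⟨max 0 (g x + c), fun n => ?_⟩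
      cases n with
      | zero => exact le_max_left _ _
      | succ n => exact max_le_max le_rfl (add_le_add_right (hc n) _)
    · rintro ⟨c, hc⟩
      refine ⟨c - g x, fun n => ?_⟩
      have := (le_max_right _ _).trans (hc (n + 1))
      linarith
  rcases hT.toPreErgodic.measure_self_or_compl_eq_zero hSm hinv with h | h
  swap
  · exact h
  exfalso
  have hunb : ∀ᵐ x ∂μ, ¬ BddAbove (Set.range fun n => maxBirkhoffSum T g n (T x)) := by
    have : ∀ᵐ x ∂μ, x ∉ S := by
      rw [ae_iff]
      simpa using h
    filter_upwards [this] with x hx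
    rw [← hinv] at hx
    exact hx
  -- If `S` is null, `M n (T x)` tends to infinity, so the integrand, which equals `M (n + 1) x - M
  -- n (T x)`, tends to `g x`. Its integral is nonnegative by invariance of `μ` and monotonicity of
  -- `M`, contradicting `∫ g < 0`.
  have hlim : Tendsto (fun n => ∫ x, max (-maxBirkhoffSum T g n (T x)) (g x) ∂μ) atTop
      (𝓝 (∫ x, g x ∂μ)) := by
    refine tendsto_integral_of_dominated_convergence (fun _ => C) (fun n => ?_)
      (integrable_const C) (fun n => Eventually.of_forall fun x => ?_) ?_
    · exact (((measurable_maxBirkhoffSum hTm hg n).comp hTm).neg.max hg).aestronglyMeasurable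
    · have h1 := maxBirkhoffSum_nonneg T g n (T x)
      have h2 := abs_le.1 (hC x)
      rw [Real.norm_eq_abs, abs_le]
      exact ⟨h2.1.trans (le_max_right _ _), max_le (by linarith) h2.2⟩
    · filter_upwards [hunb] with x hx
      have := tendsto_atTop_of_monotone (maxBirkhoffSum_mono T g (T x)) |>.resolve_right (by
        rintro ⟨l, hl⟩
        exact hx hl.bddAbove_range)
      refine tendsto_const_nhds.congr' ?_
      filter_upwards [this.eventually_ge_atTop (-g x)] with n hn
      exact (max_eq_right (by linarith)).symm
  refine absurd (ge_of_tendsto' hlim fun n => ?_) (not_le.2 hneg)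
  have hi := integrable_maxBirkhoffSum (μ := μ) hTm hg hC
  have heq : ∀ x, max (-maxBirkhoffSum T g n (T x)) (g x)
      = maxBirkhoffSum T g (n + 1) x - maxBirkhoffSum T g n (T x) := by
    intro x
    rw [maxBirkhoffSum, ← max_sub_sub_right]
    simp
  simp_rw [heq]
  have hcomp : ∫ x, maxBirkhoffSum T g n (T x) ∂μ = ∫ x, maxBirkhoffSum T g n x ∂μ := by
    conv_rhs => rw [← hT.map_eq]
    rw [integral_map hTm.aemeasurable (measurable_maxBirkhoffSum hTm hg n).aestronglyMeasurable]
  have hi' : Integrable (fun x => maxBirkhoffSum T g n (T x)) μ :=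
    hT.toMeasurePreserving.integrable_comp_of_integrable (hi n)
  rw [integral_sub (hi (n + 1)) hi', hcomp, sub_nonneg]
  exact integral_mono (hi n) (hi (n + 1)) fun x => maxBirkhoffSum_mono T g x n.le_succ

/-- The function `f - (m + ε / 2)` has integral `-ε / 2 < 0`, so its Birkhoff sums are bounded above
almost everywhere. Dividing the bound by `n` makes it smaller than the remaining `ε / 2`. -/
theorem ae_eventually_birkhoffAverage_lt (hT : Ergodic T μ) {f : X → ℝ} (hf : Measurable f)
    {C : ℝ} (hC : ∀ x, |f x| ≤ C) {ε : ℝ} (hε : 0 < ε) :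
    ∀ᵐ x ∂μ, ∀ᶠ n in atTop, birkhoffAverage ℝ T f n x < ∫ x, f x ∂μ + ε := by
  set m := ∫ x, f x ∂μ with hm
  have hfi : Integrable f μ := Integrable.of_bound hf.aestronglyMeasurable C
    (Eventually.of_forall hC)
  have hneg : ∫ x, (f x - (m + ε / 2)) ∂μ < 0 := by
    rw [integral_sub hfi (integrable_const _), integral_const]
    simp only [probReal_univ, one_smul]
    linarith
  have hb := ae_bddAbove_maxBirkhoffSum hT (g := fun x => f x - (m + ε / 2))
    (hf.sub measurable_const) (C := C + |m + ε / 2|)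
    (fun x => (abs_sub _ _).trans (by gcongr; exact hC x)) hneg
  filter_upwards [hb] with x ⟨c, hc⟩
  have hlim : Tendsto (fun n : ℕ => (n : ℝ)⁻¹ * c) atTop (𝓝 0) := by
    simpa using tendsto_inv_atTop_nhds_zero_nat.mul_const c
  filter_upwards [hlim.eventually_lt_const (half_pos hε), eventually_gt_atTop 0] with n hn hn0
  have h1 : birkhoffSum T f n x - n * (m + ε / 2) ≤ c := by
    have h2 := (birkhoffSum_le_maxBirkhoffSum T (fun x => f x - (m + ε / 2)) n x).trans
      (hc (Set.mem_range_self n))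
    simpa only [birkhoffSum, Finset.sum_sub_distrib, Finset.sum_const, Finset.card_range,
      nsmul_eq_mul] using h2
  have hn0' : (0 : ℝ) < n := by exact_mod_cast hn0
  have h3 := mul_le_mul_of_nonneg_left h1 (inv_nonneg.2 hn0'.le)
  rw [mul_sub, inv_mul_cancel_left₀ hn0'.ne'] at h3
  rw [birkhoffAverage, smul_eq_mul]
  linarith

/-- Birkhoff's pointwise ergodic theorem for bounded functions and ergodic transformations. -/
theorem ae_tendsto_birkhoffAverage (hT : Ergodic T μ) {f : X → ℝ} (hf : Measurable f)
    {C : ℝ} (hC : ∀ x, |f x| ≤ C) :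
    ∀ᵐ x ∂μ, Tendsto (fun n => birkhoffAverage ℝ T f n x) atTop (𝓝 (∫ x, f x ∂μ)) := by
  have h1 : ∀ᵐ x ∂μ, ∀ k : ℕ, ∀ᶠ n in atTop,
      birkhoffAverage ℝ T f n x < ∫ x, f x ∂μ + 1 / ((k : ℝ) + 1) :=
    ae_all_iff.2 fun k => ae_eventually_birkhoffAverage_lt hT hf hC (by positivity)
  -- The lower bound for `f` is the upper bound for `-f`.
  have h2 : ∀ᵐ x ∂μ, ∀ k : ℕ, ∀ᶠ n in atTop,
      birkhoffAverage ℝ T (-f) n x < ∫ x, (-f) x ∂μ + 1 / ((k : ℝ) + 1) :=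
    ae_all_iff.2 fun k => ae_eventually_birkhoffAverage_lt hT hf.neg
      (C := C) (by simpa using hC) (by positivity)
  filter_upwards [h1, h2] with x hx1 hx2
  rw [Metric.tendsto_nhds]
  intro ε hε
  obtain ⟨k, hk⟩ := exists_nat_one_div_lt hε
  filter_upwards [hx1 k, hx2 k] with n hn1 hn2
  rw [birkhoffAverage_neg] at hn2
  simp only [Pi.neg_apply, integral_neg] at hn2
  rw [Real.dist_eq, abs_lt]
  constructor <;> linarith

end Birkhoff

/-! ### Weak convergence of the sampling measures -/

section EmpiricalMeasure

variable {X : Type*} [TopologicalSpace X] [CompactSpace X] [TopologicalSpace.MetrizableSpace X]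
  [MeasurableSpace X] [BorelSpace X]

omit [CompactSpace X] [TopologicalSpace.MetrizableSpace X] [BorelSpace X] in
theorem isProbabilityMeasure_empMeasure (Φ : Flow ℝ X) (Δt : ℝ) (x₀ : X) {N : ℕ} (hN : N ≠ 0) :
    IsProbabilityMeasure (empMeasure Φ Δt x₀ N) := by
  refine ⟨?_⟩
  have h : ((N : ℝ≥0)⁻¹ : ℝ≥0) * (N : ℝ≥0) = 1 := inv_mul_cancel₀ (by exact_mod_cast hN)
  rw [empMeasure, Measure.smul_apply, Measure.finsetSum_apply]
  simp only [measure_univ, Finset.sum_const, Finset.card_range, nsmul_eq_mul, mul_one]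
  rw [ENNReal.smul_def, smul_eq_mul, ← ENNReal.coe_natCast, ← ENNReal.coe_mul, h, ENNReal.coe_one]

theorem integral_empMeasure {E : Type*} [NormedAddCommGroup E] [NormedSpace ℝ E] [CompleteSpace E]
    (Φ : Flow ℝ X) (Δt : ℝ) (x₀ : X) (N : ℕ) (f : C(X, E)) :
    ∫ x, f x ∂(empMeasure Φ Δt x₀ N)
      = (N : ℝ)⁻¹ • ∑ n ∈ Finset.range N, f (Φ (n * Δt) x₀) := by
  rw [empMeasure, integral_smul_nnreal_measure, integral_finsetSum_measure]
  · simp only [integral_dirac]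
    rfl
  · intro i _
    exact (integrable_dirac (by simp))

omit [CompactSpace X] [TopologicalSpace.MetrizableSpace X] [MeasurableSpace X]
  [BorelSpace X] in
theorem flow_nat_mul (Φ : Flow ℝ X) (Δt : ℝ) (n : ℕ) (x : X) :
    Φ (n * Δt) x = (Φ Δt)^[n] x := by
  induction n with
  | zero => simp
  | succ n ih =>
    rw [Function.iterate_succ_apply', ← ih, ← Φ.map_add]
    congr 1
    push_cast
    ring

theorem norm_integral_empMeasure_le (Φ : Flow ℝ X) (Δt : ℝ) (x₀ : X) (N : ℕ) (f : C(X, ℂ)) :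
    ‖∫ x, f x ∂(empMeasure Φ Δt x₀ N)‖ ≤ ‖f‖ := by
  -- For `N = 0` the sampling measure is zero rather than a probability measure.
  rcases eq_or_ne N 0 with rfl | hN
  · simp [integral_empMeasure]
  · have := isProbabilityMeasure_empMeasure Φ Δt x₀ hN
    simpa using norm_integral_le_of_norm_le_const (μ := empMeasure Φ Δt x₀ N)
      (Eventually.of_forall f.norm_coe_le_norm)

/-- The exceptional null set must not depend on `f`. Birkhoff is applied to a countable dense
sequence in `C(X)`, and the uniform bound `|∫ f dμ_N| ≤ ‖f‖` extends the limit to all `f`. -/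
theorem ae_tendsto_integral_empMeasure (Φ : Flow ℝ X) (Δt : ℝ) (μ : Measure X)
    [IsProbabilityMeasure μ] (hErg : Ergodic (Φ Δt) μ) :
    ∀ᵐ x₀ ∂μ, ∀ f : C(X, ℂ), Tendsto (fun N => ∫ x, f x ∂(empMeasure Φ Δt x₀ N)) atTop
      (𝓝 (∫ x, f x ∂μ)) := by
  let _ := TopologicalSpace.metrizableSpaceMetric X
  have hreal : ∀ f : C(X, ℝ), ∀ᵐ x₀ ∂μ,
      Tendsto (fun N => ∫ x, f x ∂(empMeasure Φ Δt x₀ N)) atTop (𝓝 (∫ x, f x ∂μ)) := by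
    intro f
    filter_upwards [ae_tendsto_birkhoffAverage hErg f.continuous.measurable (C := ‖f‖)
      fun x => f.norm_coe_le_norm x] with x hx
    refine hx.congr fun N => ?_
    simp only [integral_empMeasure, birkhoffAverage, birkhoffSum, flow_nat_mul]
  have hcomplex : ∀ f : C(X, ℂ), ∀ᵐ x₀ ∂μ,
      Tendsto (fun N => ∫ x, f x ∂(empMeasure Φ Δt x₀ N)) atTop (𝓝 (∫ x, f x ∂μ)) := by
    intro f
    have hint : ∀ (ν : Measure X) [IsFiniteMeasure ν], Integrable f ν := fun ν _ =>
      f.continuous.integrable_of_hasCompactSupport (HasCompactSupport.of_compactSpace f)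
    filter_upwards [hreal ⟨fun x => (f x).re, by fun_prop⟩,
      hreal ⟨fun x => (f x).im, by fun_prop⟩] with x hre him
    have h : ∀ (ν : Measure X) [IsFiniteMeasure ν],
        ∫ x, f x ∂ν = (∫ x, (f x).re ∂ν : ℝ) + (∫ x, (f x).im ∂ν : ℝ) * Complex.I :=
      fun ν _ => (integral_re_add_im (hint ν)).symm
    simp_rw [h]
    exact ((Complex.continuous_ofReal.tendsto _).comp hre).add
      (((Complex.continuous_ofReal.tendsto _).comp him).mul_const _)
  have hdense : ∀ᵐ x₀ ∂μ, ∀ n, Tendsto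
      (fun N => ∫ x, TopologicalSpace.denseSeq C(X, ℂ) n x ∂(empMeasure Φ Δt x₀ N)) atTop
      (𝓝 (∫ x, TopologicalSpace.denseSeq C(X, ℂ) n x ∂μ)) := ae_all_iff.2 fun n => hcomplex _
  filter_upwards [hdense] with x₀ hx f
  rw [Metric.tendsto_nhds]
  intro ε hε
  obtain ⟨n, hn⟩ := (TopologicalSpace.denseRange_denseSeq C(X, ℂ)).exists_dist_lt f
    (ε := ε / 3) (by positivity)
  set g := TopologicalSpace.denseSeq C(X, ℂ) n
  rw [dist_eq_norm] at hn
  filter_upwards [Metric.tendsto_nhds.1 (hx n) (ε / 3) (by positivity)] with N hN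
  have hint : ∀ (ν : Measure X) [IsFiniteMeasure ν] (f : C(X, ℂ)), Integrable f ν := fun ν _ f =>
    f.continuous.integrable_of_hasCompactSupport (HasCompactSupport.of_compactSpace f)
  have h1 : dist (∫ x, f x ∂(empMeasure Φ Δt x₀ N)) (∫ x, g x ∂(empMeasure Φ Δt x₀ N))
      < ε / 3 := by
    rw [dist_eq_norm, ← integral_sub (hint _ f) (hint _ g)]
    exact (norm_integral_empMeasure_le Φ Δt x₀ N (f - g)).trans_lt hn
  have h2 : dist (∫ x, g x ∂μ) (∫ x, f x ∂μ) < ε / 3 := by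
    rw [dist_comm, dist_eq_norm, ← integral_sub (hint _ f) (hint _ g)]
    refine lt_of_le_of_lt ?_ hn
    simpa using norm_integral_le_of_norm_le_const (μ := μ)
      (Eventually.of_forall (f - g).norm_coe_le_norm)
  have h3 := dist_triangle4 (∫ x, f x ∂(empMeasure Φ Δt x₀ N)) (∫ x, g x ∂(empMeasure Φ Δt x₀ N))
    (∫ x, g x ∂μ) (∫ x, f x ∂μ)
  change dist (∫ x, g x ∂(empMeasure Φ Δt x₀ N)) (∫ x, g x ∂μ) < ε / 3 at hN
  linarith

end EmpiricalMeasure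

/-! ### Kernel integral operators -/

section KernelOperators

open ContinuousLinearMap

variable {X : Type*} [TopologicalSpace X] [CompactSpace X] [TopologicalSpace.MetrizableSpace X]
  [MeasurableSpace X] [BorelSpace X]

theorem coeFn_iota (ν : Measure X) [IsFiniteMeasure ν] (f : C(X, ℂ)) : iota ν f =ᵐ[ν] f :=
  ContinuousMap.coeFn_toLp ν f

theorem inner_iota_iota (ν : Measure X) [IsFiniteMeasure ν] (f g : C(X, ℂ)) :
    inner ℂ (iota ν f) (iota ν g) = ∫ x, (star f * g) x ∂ν := by
  rw [iota, ContinuousMap.inner_toLp]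
  refine integral_congr_ae (Eventually.of_forall fun x => ?_)
  simp [mul_comm]

theorem norm_iota_le (ν : Measure X) [IsProbabilityMeasure ν] (f : C(X, ℂ)) :
    ‖iota ν f‖ ≤ ‖f‖ := by
  refine ((iota ν).le_of_opNorm_le (c := 1) ?_ f).trans_eq (one_mul _)
  refine (ContinuousMap.toLp_norm_le (p := 2) (μ := ν) (𝕜 := ℂ)).trans_eq ?_
  simp [measureUnivNNReal]

/-- The function `x' ↦ k (x, x')`. -/
def kernelSection (k : C(X × X, ℝ)) (x : X) : C(X, ℂ) where
  toFun x' := (k (x, x') : ℂ)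
  continuous_toFun := by fun_prop

omit [TopologicalSpace.MetrizableSpace X] [MeasurableSpace X] [BorelSpace X] in
theorem norm_kernelSection_le (k : C(X × X, ℝ)) (x : X) : ‖kernelSection k x‖ ≤ ‖k‖ := by
  refine (ContinuousMap.norm_le _ (norm_nonneg k)).2 fun x' => ?_
  exact (Complex.norm_real _).trans_le (k.norm_coe_le_norm (x, x'))

omit [TopologicalSpace.MetrizableSpace X] [MeasurableSpace X] [BorelSpace X] in
theorem continuous_kernelSection (k : C(X × X, ℝ)) : Continuous (kernelSection k) :=
  ContinuousMap.continuous_of_continuous_uncurry _ (by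
    change Continuous fun p : X × X => (k (p.1, p.2) : ℂ)
    fun_prop)

/-- As the kernel is real, no conjugation intervenes. In this form linearity is immediate and
sup-norm estimates reduce to Cauchy–Schwarz. -/
theorem kernelInt_apply (ν : Measure X) [IsFiniteMeasure ν] (k : C(X × X, ℝ)) (f : Lp ℂ 2 ν)
    (x : X) : kernelInt ν k f x = inner ℂ (iota ν (kernelSection k x)) f := by
  rw [L2.inner_def]
  refine integral_congr_ae ?_
  filter_upwards [coeFn_iota ν (kernelSection k x)] with x' hx'
  rw [hx']
  simp [kernelSection, mul_comm]

/-- The map `f ↦ ∫ k(·, x) f(x) dν(x)` as a linear map. -/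
def kernelIntLin (ν : Measure X) [IsFiniteMeasure ν] (k : C(X × X, ℝ)) :
    Lp ℂ 2 ν →ₗ[ℂ] C(X, ℂ) where
  toFun := kernelInt ν k
  map_add' f g := by
    ext x
    simp only [ContinuousMap.add_apply, kernelInt_apply, inner_add_right]
  map_smul' c f := by
    ext x
    simp only [ContinuousMap.smul_apply, kernelInt_apply, inner_smul_right, RingHom.id_apply,
      smul_eq_mul]

theorem kernelIntLin_apply (ν : Measure X) [IsFiniteMeasure ν] (k : C(X × X, ℝ))
    (f : Lp ℂ 2 ν) : kernelIntLin ν k f = kernelInt ν k f := rfl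

omit [TopologicalSpace.MetrizableSpace X] [MeasurableSpace X] [BorelSpace X] in
theorem kernelSection_sub (k k' : C(X × X, ℝ)) (x : X) :
    kernelSection (k - k') x = kernelSection k x - kernelSection k' x := by
  ext x'
  simp [kernelSection]

theorem kernelInt_sub_kernel (ν : Measure X) [IsFiniteMeasure ν] (k k' : C(X × X, ℝ))
    (f : Lp ℂ 2 ν) : kernelInt ν (k - k') f = kernelInt ν k f - kernelInt ν k' f := by
  ext x
  simp only [ContinuousMap.sub_apply, kernelInt_apply, kernelSection_sub, map_sub, inner_sub_left]

end KernelOperators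

/-! ### Multiplication operators and effects -/

section MultiplicationOperators

open ContinuousLinearMap

variable {X : Type*} [TopologicalSpace X] [CompactSpace X] [TopologicalSpace.MetrizableSpace X]
  [MeasurableSpace X] [BorelSpace X]

/-- Multiplication by a continuous function. -/
def mulCont (ν : Measure X) [IsFiniteMeasure ν] (g : C(X, ℂ)) : Lp ℂ 2 ν →L[ℂ] Lp ℂ 2 ν :=
  mulRep ν (ContinuousMap.toLp ∞ ν ℂ g)

theorem coeFn_mulCont (ν : Measure X) [IsFiniteMeasure ν] (g : C(X, ℂ)) (f : Lp ℂ 2 ν) :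
    mulCont ν g f =ᵐ[ν] fun x => g x * f x := by
  have h := (ContinuousLinearMap.mul ℂ ℂ).coeFn_holder (r := 2)
    (ContinuousMap.toLp ∞ ν ℂ g) f
  filter_upwards [h, ContinuousMap.coeFn_toLp (p := ∞) (𝕜 := ℂ) ν g] with x hx hg
  rw [← hg]
  exact hx

theorem mulCont_iota (ν : Measure X) [IsFiniteMeasure ν] (g f : C(X, ℂ)) :
    mulCont ν g (iota ν f) = iota ν (g * f) := by
  apply Lp.ext
  filter_upwards [coeFn_mulCont ν g (iota ν f), coeFn_iota ν f, coeFn_iota ν (g * f)]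
    with x h1 h2 h3
  rw [h1, h2, h3, ContinuousMap.mul_apply]

theorem mulCont_one (ν : Measure X) [IsFiniteMeasure ν] : mulCont ν 1 = 1 := by
  ext1 f
  apply Lp.ext
  filter_upwards [coeFn_mulCont ν 1 f] with x h1
  rw [h1]
  simp

theorem mulCont_sub (ν : Measure X) [IsFiniteMeasure ν] (g g' : C(X, ℂ)) :
    mulCont ν (g - g') = mulCont ν g - mulCont ν g' := by
  simp [mulCont]

open scoped ComplexOrder in
-- The quadratic form at `f` is the integral of `g |f|²`.
theorem mulCont_nonneg (ν : Measure X) [IsFiniteMeasure ν] {g : C(X, ℂ)} (hg : ∀ x, 0 ≤ g x) :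
    0 ≤ mulCont ν g := by
  rw [nonneg_iff_isPositive, isPositive_iff_complex]
  intro f
  have h : inner ℂ (mulCont ν g f) f = ((∫ x, (g x).re * ‖f x‖ ^ 2 ∂ν : ℝ) : ℂ) := by
    rw [L2.inner_def, ← integral_complex_ofReal]
    refine integral_congr_ae ?_
    filter_upwards [coeFn_mulCont ν g f] with x hx
    have h1 : ((g x).re : ℂ) = g x := (Complex.eq_re_of_ofReal_le (hg x)).symm
    rw [hx, RCLike.inner_apply, map_mul, Complex.ofReal_mul, h1, ← h1, Complex.conj_ofReal,
      Complex.ofReal_pow, ← Complex.mul_conj']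
    ring
  rw [h]
  refine ⟨by simp, ?_⟩
  rw [RCLike.re_to_complex, Complex.ofReal_re]
  exact integral_nonneg fun x => mul_nonneg (Complex.nonneg_iff.1 (hg x)).1 (by positivity)

variable {Y : Type*} [TopologicalSpace Y]

theorem effect_eq_mulCont (ν : Measure X) [IsFiniteMeasure ν] (ψ : C(Y × Y, unitInterval))
    (h : C(X, Y)) (y : Y) : effect ν ψ h y = mulCont ν (featureFun ψ h y) := rfl

open scoped ComplexOrder in
theorem effect_nonneg (ν : Measure X) [IsFiniteMeasure ν] (ψ : C(Y × Y, unitInterval))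
    (h : C(X, Y)) (y : Y) : 0 ≤ effect ν ψ h y :=
  mulCont_nonneg ν fun x => by
    change (0 : ℂ) ≤ (((ψ (y, h x) : unitInterval) : ℝ) : ℂ)
    exact_mod_cast (ψ (y, h x)).2.1

open scoped ComplexOrder in
theorem effect_le_one (ν : Measure X) [IsFiniteMeasure ν] (ψ : C(Y × Y, unitInterval))
    (h : C(X, Y)) (y : Y) : effect ν ψ h y ≤ 1 := by
  rw [← sub_nonneg, effect_eq_mulCont, ← mulCont_one, ← mulCont_sub]
  refine mulCont_nonneg ν fun x => ?_
  change (0 : ℂ) ≤ 1 - (((ψ (y, h x) : unitInterval) : ℝ) : ℂ)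
  have := (ψ (y, h x)).2.2
  rw [sub_nonneg]
  exact_mod_cast this

theorem effect_iota (ν : Measure X) [IsFiniteMeasure ν] (ψ : C(Y × Y, unitInterval))
    (h : C(X, Y)) (y : Y) (f : C(X, ℂ)) :
    effect ν ψ h y (iota ν f) = iota ν (featureFun ψ h y * f) :=
  mulCont_iota ν _ f

end MultiplicationOperators

/-! ### Limits of inner products and kernel integrals along the samples -/

section DataLimits

variable {X : Type*} [TopologicalSpace X] [CompactSpace X] [TopologicalSpace.MetrizableSpace X]
  [MeasurableSpace X] [BorelSpace X] {Φ : Flow ℝ X} {Δt : ℝ} {x₀ : X}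
  {μ : Measure X} [IsProbabilityMeasure μ]

theorem tendsto_integral_of_tendsto
    (hw : ∀ f : C(X, ℂ), Tendsto (fun N => ∫ x, f x ∂(empMeasure Φ Δt x₀ N)) atTop
      (𝓝 (∫ x, f x ∂μ))) {f : ℕ → C(X, ℂ)} {f' : C(X, ℂ)} (hf : Tendsto f atTop (𝓝 f')) :
    Tendsto (fun N => ∫ x, f N x ∂(empMeasure Φ Δt x₀ N)) atTop (𝓝 (∫ x, f' x ∂μ)) := by
  have hint : ∀ (ν : Measure X) [IsFiniteMeasure ν] (f : C(X, ℂ)), Integrable f ν := fun ν _ f =>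
    f.continuous.integrable_of_hasCompactSupport (HasCompactSupport.of_compactSpace f)
  have h1 : Tendsto (fun N => ∫ x, (f N - f') x ∂(empMeasure Φ Δt x₀ N)) atTop (𝓝 0) :=
    squeeze_zero_norm (fun N => norm_integral_empMeasure_le Φ Δt x₀ N _)
      (tendsto_zero_iff_norm_tendsto_zero.1 (tendsto_sub_nhds_zero_iff.2 hf))
  have h2 := h1.add (hw f')
  rw [zero_add] at h2
  refine h2.congr fun N => ?_
  rw [← integral_add (hint _ _) (hint _ _)]
  simp

theorem tendsto_inner_iota
    (hw : ∀ f : C(X, ℂ), Tendsto (fun N => ∫ x, f x ∂(empMeasure Φ Δt x₀ N)) atTop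
      (𝓝 (∫ x, f x ∂μ))) {f g : ℕ → C(X, ℂ)} {f' g' : C(X, ℂ)} (hf : Tendsto f atTop (𝓝 f'))
    (hg : Tendsto g atTop (𝓝 g')) :
    Tendsto (fun N => inner ℂ (iota (empMeasure Φ Δt x₀ N) (f N))
      (iota (empMeasure Φ Δt x₀ N) (g N))) atTop (𝓝 (inner ℂ (iota μ f') (iota μ g'))) := by
  simp only [inner_iota_iota]
  exact tendsto_integral_of_tendsto hw (((continuous_star.tendsto _).comp hf).mul hg)

theorem norm_iota_empMeasure_le (N : ℕ) (f : C(X, ℂ)) :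
    ‖iota (empMeasure Φ Δt x₀ N) f‖ ≤ ‖f‖ := by
  have h : ‖iota (empMeasure Φ Δt x₀ N) f‖ ^ 2 ≤ ‖f‖ ^ 2 := by
    have h1 := norm_integral_empMeasure_le Φ Δt x₀ N (star f * f)
    rw [← inner_iota_iota, inner_self_eq_norm_sq_to_K, norm_pow, RCLike.norm_ofReal,
      abs_norm] at h1
    refine h1.trans ((norm_mul_le _ _).trans_eq ?_)
    rw [norm_star, sq]
  exact le_of_sq_le_sq h (norm_nonneg _)

/-- A bound from `L²(μ_N)` to the sup norm that is uniform in `N`: it is what upgrades `L²`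
convergence to uniform convergence. -/
theorem norm_kernelInt_empMeasure_le (N : ℕ) (k : C(X × X, ℝ)) (f : DataSpace Φ Δt x₀ N) :
    ‖kernelInt (empMeasure Φ Δt x₀ N) k f‖ ≤ ‖k‖ * ‖f‖ := by
  refine (ContinuousMap.norm_le _ (by positivity)).2 fun x => ?_
  rw [kernelInt_apply]
  exact (norm_inner_le_norm _ _).trans (mul_le_mul_of_nonneg_right
    ((norm_iota_empMeasure_le N _).trans (norm_kernelSection_le k x)) (norm_nonneg _))

/-- Pointwise convergence comes from weak convergence of the measures. It is locally uniform because
`x ↦ k (x, ·)` is continuous into `C(X)`, making the integrals equicontinuous in `x` uniformly in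
`N`; compactness concludes. -/
theorem tendsto_kernelInt_iota_const
    (hw : ∀ f : C(X, ℂ), Tendsto (fun N => ∫ x, f x ∂(empMeasure Φ Δt x₀ N)) atTop
      (𝓝 (∫ x, f x ∂μ))) (k : C(X × X, ℝ)) (g : C(X, ℂ)) :
    Tendsto (fun N => kernelInt (empMeasure Φ Δt x₀ N) k (iota _ g)) atTop
      (𝓝 (kernelInt μ k (iota μ g))) := by
  rw [ContinuousMap.tendsto_iff_tendstoUniformly,
    ← tendstoLocallyUniformly_iff_tendstoUniformly_of_compactSpace,
    Metric.tendstoLocallyUniformly_iff]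
  intro ε hε x
  set δ := ε / (3 * (‖g‖ + 1)) with hδ
  have hδ0 : 0 < δ := by positivity
  refine ⟨{x' | dist (kernelSection k x') (kernelSection k x) < δ}, ?_, ?_⟩
  · exact Metric.continuousAt_iff'.1 (continuous_kernelSection k).continuousAt δ hδ0
  have hδg : δ * ‖g‖ < ε / 3 := by
    rw [hδ, div_mul_eq_mul_div, div_lt_div_iff₀ (by positivity) (by positivity)]
    nlinarith [norm_nonneg g]
  have hx : Tendsto (fun N => kernelInt (empMeasure Φ Δt x₀ N) k (iota _ g) x) atTop
      (𝓝 (kernelInt μ k (iota μ g) x)) := by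
    simp only [kernelInt_apply]
    exact tendsto_inner_iota hw tendsto_const_nhds tendsto_const_nhds
  filter_upwards [Metric.tendsto_nhds.1 hx (ε / 3) (by positivity)] with N hN x' hx'
  change dist _ _ < δ at hx'
  rw [dist_eq_norm] at hx'
  have h1 : dist (kernelInt μ k (iota μ g) x') (kernelInt μ k (iota μ g) x) < ε / 3 := by
    rw [dist_eq_norm, kernelInt_apply, kernelInt_apply, ← inner_sub_left, ← map_sub]
    refine ((norm_inner_le_norm _ _).trans (mul_le_mul ((norm_iota_le μ _).trans hx'.le)
      (norm_iota_le μ g) (norm_nonneg _) hδ0.le)).trans_lt hδg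
  have h2 : dist (kernelInt (empMeasure Φ Δt x₀ N) k (iota _ g) x)
      (kernelInt (empMeasure Φ Δt x₀ N) k (iota _ g) x') < ε / 3 := by
    rw [dist_comm, dist_eq_norm, kernelInt_apply, kernelInt_apply, ← inner_sub_left, ← map_sub]
    refine ((norm_inner_le_norm _ _).trans (mul_le_mul
      ((norm_iota_empMeasure_le N _).trans hx'.le)
      (norm_iota_empMeasure_le N g) (norm_nonneg _) hδ0.le)).trans_lt hδg
  rw [dist_comm] at hN
  have h3 := dist_triangle4 (kernelInt μ k (iota μ g) x') (kernelInt μ k (iota μ g) x)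
    (kernelInt (empMeasure Φ Δt x₀ N) k (iota _ g) x)
    (kernelInt (empMeasure Φ Δt x₀ N) k (iota _ g) x')
  linarith

theorem tendsto_kernelInt_iota
    (hw : ∀ f : C(X, ℂ), Tendsto (fun N => ∫ x, f x ∂(empMeasure Φ Δt x₀ N)) atTop
      (𝓝 (∫ x, f x ∂μ))) {k : C(X × X, ℝ)} {kN : ℕ → C(X × X, ℝ)}
    (hk : Tendsto kN atTop (𝓝 k)) (g : C(X, ℂ)) :
    Tendsto (fun N => kernelInt (empMeasure Φ Δt x₀ N) (kN N) (iota _ g)) atTop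
      (𝓝 (kernelInt μ k (iota μ g))) := by
  have h1 : Tendsto (fun N => kernelInt (empMeasure Φ Δt x₀ N) (kN N - k) (iota _ g)) atTop
      (𝓝 0) := by
    have h0 := (tendsto_zero_iff_norm_tendsto_zero.1 (tendsto_sub_nhds_zero_iff.2 hk)).mul_const
      ‖g‖
    rw [zero_mul] at h0
    refine squeeze_zero_norm (fun N => ?_) h0
    exact (norm_kernelInt_empMeasure_le N _ _).trans
      (mul_le_mul_of_nonneg_left (norm_iota_empMeasure_le N g) (norm_nonneg _))
  have h2 := h1.add (tendsto_kernelInt_iota_const hw k g)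
  rw [zero_add] at h2
  refine h2.congr fun N => ?_
  rw [kernelInt_sub_kernel, sub_add_cancel]

theorem tendsto_kernelInt_zero {k : C(X × X, ℝ)} {kN : ℕ → C(X × X, ℝ)}
    (hk : Tendsto kN atTop (𝓝 k)) {f : ∀ N, DataSpace Φ Δt x₀ N}
    (hf : Tendsto (fun N => ‖f N‖) atTop (𝓝 0)) :
    Tendsto (fun N => kernelInt (empMeasure Φ Δt x₀ N) (kN N) (f N)) atTop (𝓝 0) := by
  have h := hk.norm.mul hf
  rw [mul_zero] at h
  exact squeeze_zero_norm (fun N => norm_kernelInt_empMeasure_le N _ _) h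

end DataLimits

/-! ### Uniform convergence of rotated eigenvectors -/

section DataEigenbasis

variable {X : Type*} [TopologicalSpace X] [CompactSpace X] [TopologicalSpace.MetrizableSpace X]
  [MeasurableSpace X] [BorelSpace X] {Φ : Flow ℝ X} {Δt : ℝ} {x₀ : X}
  {μ : Measure X} [IsProbabilityMeasure μ]
  {k : C(X × X, ℝ)} {kN : ℕ → C(X × X, ℝ)} {lamN : ∀ N, Fin N → ℝ}
  {e : ∀ N, OrthonormalBasis (Fin N) ℂ (DataSpace Φ Δt x₀ N)}

theorem kernelOp_sum {ν : Measure X} [IsFiniteMeasure ν] {k : C(X × X, ℝ)} {ι : Type*}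
    (s : Finset ι) (c : ι → ℂ) (f : ι → Lp ℂ 2 ν) :
    kernelOp ν k (∑ m ∈ s, c m • f m) = ∑ m ∈ s, c m • kernelOp ν k (f m) := by
  simp only [kernelOp, ← kernelIntLin_apply, map_sum, map_smul]

theorem iota_contRep {ν : Measure X} [IsFiniteMeasure ν] {k : C(X × X, ℝ)} {lam : ℝ}
    (hlam : lam ≠ 0) {f : Lp ℂ 2 ν} (hf : kernelOp ν k f = (lam : ℂ) • f) :
    iota ν (contRep ν k lam f) = f := by
  rw [contRep, map_smul]
  change (lam : ℂ)⁻¹ • kernelOp ν k f = f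
  rw [hf, inv_smul_smul₀ (by exact_mod_cast hlam)]

theorem norm_sum_smul_sq {N : ℕ} {H : Type*} [NormedAddCommGroup H] [InnerProductSpace ℂ H]
    (b : OrthonormalBasis (Fin N) ℂ H) (c : Fin N → ℂ) :
    ‖∑ m, c m • b m‖ ^ 2 = ∑ m, ‖c m‖ ^ 2 := by
  rw [← b.sum_sq_norm_inner_right]
  refine Finset.sum_congr rfl fun m _ => ?_
  rw [b.orthonormal.inner_right_fintype]

theorem norm_sum_ofReal_smul {N : ℕ} {H : Type*} [NormedAddCommGroup H] [InnerProductSpace ℂ H]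
    (b : OrthonormalBasis (Fin N) ℂ H) (v : EuclideanSpace ℝ (Fin N)) :
    ‖∑ m, (v m : ℂ) • b m‖ = ‖v‖ := by
  rw [← sq_eq_sq₀ (norm_nonneg _) (norm_nonneg _), norm_sum_smul_sq, EuclideanSpace.norm_sq_eq]
  simp

/-- Convergence of the continuous representatives follows from the convergence in `L²(X, μ_N)` and
of the eigenvalues. -/
theorem tendsto_rotRep
    (hw : ∀ f : C(X, ℂ), Tendsto (fun N => ∫ x, f x ∂(empMeasure Φ Δt x₀ N)) atTop
      (𝓝 (∫ x, f x ∂μ))) (hk : Tendsto kN atTop (𝓝 k))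
    {O : ∀ N, Matrix (Fin N) (Fin N) ℝ} (hO : ∀ N, O N ∈ Matrix.orthogonalGroup (Fin N) ℝ)
    {lam : ℝ} (hlam : lam ≠ 0) {f : Lp ℂ 2 μ} (hf : kernelOp μ k f = (lam : ℂ) • f) (l : ℕ)
    (hcl : ∀ ε > 0, ∀ᶠ N in atTop, ∀ (hl : l < N) (m : Fin N),
      O N ⟨l, hl⟩ m ≠ 0 → |lamN N m - lam| < ε)
    (hL2 : Tendsto (fun N => ‖rotBasis e O N l - iota _ (contRep μ k lam f)‖) atTop (𝓝 0)) :
    Tendsto (fun N => rotRep kN lamN e O N l) atTop (𝓝 (contRep μ k lam f)) := by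
  -- The vector `w` carries the error of replacing every `(lamN N m)⁻¹` by `lam⁻¹`. Writing `g` for
  -- the limit representative, `rotRep` is `K_N w + lam⁻¹ K_N (rotBasis - ι_N g) + lam⁻¹ K_N (ι_N
  -- g)` once `l < N`, and only the last term survives in the limit.
  set w : ∀ N, DataSpace Φ Δt x₀ N := fun N =>
    if hl : l < N then ∑ m, ((O N ⟨l, hl⟩ m * ((lamN N m)⁻¹ - lam⁻¹) : ℝ) : ℂ) • e N m else 0
    with hwdef
  have hw0 : Tendsto (fun N => ‖w N‖) atTop (𝓝 0) := by
    rw [Metric.tendsto_nhds]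
    intro ε hε
    have hinv : Tendsto (fun t : ℝ => t⁻¹) (𝓝 lam) (𝓝 lam⁻¹) := (continuousAt_inv₀ hlam).tendsto
    -- Continuity of inversion at `lam ≠ 0` makes every contributing factor less than `ε / 2`; since
    -- rows of `O` are unit vectors, `‖w‖ ≤ ε / 2`.
    obtain ⟨η, hη, hηε⟩ := Metric.tendsto_nhds_nhds.1 hinv (ε / 2) (by positivity)
    filter_upwards [hcl η hη, eventually_gt_atTop l] with N hN hl
    rw [dist_zero_right, norm_norm]
    refine lt_of_le_of_lt ?_ (half_lt_self hε)
    refine le_of_sq_le_sq ?_ (by positivity)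
    have hrow : ∑ m, O N ⟨l, hl⟩ m ^ 2 = 1 := by
      have := congrFun (congrFun ((Matrix.mem_orthogonalGroup_iff _ _).1 (hO N)) ⟨l, hl⟩) ⟨l, hl⟩
      simpa [Matrix.mul_apply, sq] using this
    simp only [hwdef, dif_pos hl]
    rw [norm_sum_smul_sq]
    calc ∑ m, ‖((O N ⟨l, hl⟩ m * ((lamN N m)⁻¹ - lam⁻¹) : ℝ) : ℂ)‖ ^ 2
        ≤ ∑ m, O N ⟨l, hl⟩ m ^ 2 * (ε / 2) ^ 2 := by
          refine Finset.sum_le_sum fun m _ => ?_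
          rw [Complex.norm_real, norm_mul, mul_pow, Real.norm_eq_abs, sq_abs]
          rcases eq_or_ne (O N ⟨l, hl⟩ m) 0 with h0 | h0
          · simp [h0]
          · have h1 := hηε (x := lamN N m) (by rw [Real.dist_eq]; exact hN hl m h0)
            rw [Real.dist_eq] at h1
            exact mul_le_mul_of_nonneg_left
              (pow_le_pow_left₀ (norm_nonneg _) h1.le 2) (sq_nonneg _)
      _ = (ε / 2) ^ 2 := by rw [← Finset.sum_mul, hrow, one_mul]
  have h1 := tendsto_kernelInt_zero hk hw0
  have h2 := (tendsto_kernelInt_zero hk hL2).const_smul (lam : ℂ)⁻¹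
  have h3 := (tendsto_kernelInt_iota hw hk (contRep μ k lam f)).const_smul (lam : ℂ)⁻¹
  have h4 := (h1.add h2).add h3
  rw [iota_contRep hlam hf, smul_zero, zero_add, zero_add] at h4
  refine h4.congr' ?_
  filter_upwards [eventually_gt_atTop l] with N hl
  rw [add_assoc, ← smul_add]
  simp only [← kernelIntLin_apply]
  rw [← map_add, sub_add_cancel]
  simp only [hwdef, rotBasis, rotRep, dif_pos hl, map_sum, map_smul, Finset.smul_sum, contRep,
    ← kernelIntLin_apply, ← Finset.sum_add_distrib, smul_smul, ← add_smul]
  refine Finset.sum_congr rfl fun m _ => ?_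
  congr 1
  push_cast
  ring

end DataEigenbasis

/-! ### Gram–Schmidt for almost orthonormal families -/

section GramSchmidt

open InnerProductSpace

variable {E : ℕ → Type*} [∀ N, NormedAddCommGroup (E N)] [∀ N, InnerProductSpace ℝ (E N)]

theorem tendsto_norm_of_norm_sub {a b : ∀ N, E N} {c : ℝ}
    (ha : Tendsto (fun N => ‖a N‖) atTop (𝓝 c))
    (hab : Tendsto (fun N => ‖b N - a N‖) atTop (𝓝 0)) :
    Tendsto (fun N => ‖b N‖) atTop (𝓝 c) := by
  have h : Tendsto (fun N => ‖b N‖ - ‖a N‖) atTop (𝓝 0) :=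
    squeeze_zero_norm (fun N => abs_norm_sub_norm_le _ _) hab
  simpa using h.add ha

theorem tendsto_inner_of_norm_sub {a a' b b' : ∀ N, E N} {c ca cb : ℝ}
    (ha : Tendsto (fun N => ‖a N‖) atTop (𝓝 ca)) (hb : Tendsto (fun N => ‖b N‖) atTop (𝓝 cb))
    (haa : Tendsto (fun N => ‖a' N - a N‖) atTop (𝓝 0))
    (hbb : Tendsto (fun N => ‖b' N - b N‖) atTop (𝓝 0))
    (h : Tendsto (fun N => inner ℝ (a N) (b N)) atTop (𝓝 c)) :
    Tendsto (fun N => inner ℝ (a' N) (b' N)) atTop (𝓝 c) := by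
  have hb' := tendsto_norm_of_norm_sub hb hbb
  have hlim : Tendsto (fun N => ‖a' N - a N‖ * ‖b' N‖ + ‖a N‖ * ‖b' N - b N‖) atTop (𝓝 0) := by
    simpa using (haa.mul hb').add (ha.mul hbb)
  have h0 : Tendsto (fun N => inner ℝ (a' N) (b' N) - inner ℝ (a N) (b N)) atTop (𝓝 0) := by
    refine squeeze_zero_norm (fun N => ?_) hlim
    have : inner ℝ (a' N) (b' N) - inner ℝ (a N) (b N)
        = inner ℝ (a' N - a N) (b' N) + inner ℝ (a N) (b' N - b N) := by
      rw [inner_sub_left, inner_sub_right]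
      ring
    rw [this]
    exact (norm_add_le _ _).trans (add_le_add (norm_inner_le_norm _ _) (norm_inner_le_norm _ _))
  simpa using h0.add h

theorem gramSchmidt_eq_zero_of_eq_zero {F : Type*} [NormedAddCommGroup F] [InnerProductSpace ℝ F]
    {f : ℕ → F} {l : ℕ} (hl : f l = 0) : gramSchmidt ℝ f l = 0 := by
  rw [gramSchmidt_def, hl]
  simp

/-- The Gram–Schmidt process changes an asymptotically orthonormal family by an asymptotically
negligible amount. -/
theorem tendsto_gramSchmidt_sub {f : ∀ N, ℕ → E N} {S : Set ℕ}
    (h0 : ∀ l ∉ S, ∀ N, f N l = 0)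
    (hnorm : ∀ l ∈ S, Tendsto (fun N => ‖f N l‖) atTop (𝓝 1))
    (horth : ∀ i ∈ S, ∀ l ∈ S, i ≠ l → Tendsto (fun N => inner ℝ (f N i) (f N l)) atTop (𝓝 0))
    (l : ℕ) (hl : l ∈ S) :
    Tendsto (fun N => ‖gramSchmidt ℝ (f N) l - f N l‖) atTop (𝓝 0) := by
  induction l using Nat.strong_induction_on with
  | _ l ih =>
    -- By induction the earlier Gram–Schmidt vectors are close to the `f N i`, hence almost
    -- orthogonal to `f N l`. Indices outside `S` carry zero vectors and contribute nothing.
    have hterm : ∀ i ∈ Finset.Iio l, Tendsto (fun N =>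
        ‖(ℝ ∙ gramSchmidt ℝ (f N) i).starProjection (f N l)‖) atTop (𝓝 0) := by
      intro i hi
      rw [Finset.mem_Iio] at hi
      by_cases hiS : i ∈ S
      · have hg := ih i hi hiS
        have hgn := tendsto_norm_of_norm_sub (hnorm i hiS) hg
        have hin := tendsto_inner_of_norm_sub (b' := fun N => f N l) (hnorm i hiS) (hnorm l hl)
          hg (by simp) (horth i hiS l hl hi.ne)
        have := (hin.norm.div (hgn.pow 2) (by simp)).mul hgn
        simp only [norm_zero, one_pow, div_one, mul_one] at this
        refine this.congr fun N => ?_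
        rw [Submodule.starProjection_singleton, norm_smul, norm_div]
        simp
      · refine tendsto_const_nhds.congr fun N => ?_
        rw [gramSchmidt_eq_zero_of_eq_zero (h0 i hiS N), Submodule.starProjection_singleton]
        simp
    have hsum := tendsto_finsetSum (Finset.Iio l) hterm
    rw [Finset.sum_const_zero] at hsum
    refine squeeze_zero (fun _ => norm_nonneg _) (fun N => ?_) hsum
    rw [gramSchmidt_def, sub_sub_cancel_left, norm_neg]
    exact norm_sum_le _ _

theorem tendsto_gramSchmidtNormed_sub {f : ∀ N, ℕ → E N} {S : Set ℕ}
    (h0 : ∀ l ∉ S, ∀ N, f N l = 0)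
    (hnorm : ∀ l ∈ S, Tendsto (fun N => ‖f N l‖) atTop (𝓝 1))
    (horth : ∀ i ∈ S, ∀ l ∈ S, i ≠ l → Tendsto (fun N => inner ℝ (f N i) (f N l)) atTop (𝓝 0))
    (l : ℕ) (hl : l ∈ S) :
    Tendsto (fun N => ‖gramSchmidtNormed ℝ (f N) l - f N l‖) atTop (𝓝 0) := by
  have hg := tendsto_gramSchmidt_sub h0 hnorm horth l hl
  have hgn := tendsto_norm_of_norm_sub (hnorm l hl) hg
  have h1 : Tendsto (fun N => |‖gramSchmidt ℝ (f N) l‖⁻¹ - 1| * ‖gramSchmidt ℝ (f N) l‖) atTop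
      (𝓝 0) := by
    simpa using (((hgn.inv₀ one_ne_zero).sub_const 1).abs).mul hgn
  have h2 := h1.add hg
  rw [zero_add] at h2
  refine squeeze_zero (fun _ => norm_nonneg _) (fun N => ?_) h2
  have h3 : gramSchmidtNormed ℝ (f N) l - f N l
      = (‖gramSchmidt ℝ (f N) l‖⁻¹ - 1) • gramSchmidt ℝ (f N) l
        + (gramSchmidt ℝ (f N) l - f N l) := by
    rw [gramSchmidtNormed, sub_smul, one_smul]
    simp
  rw [h3]
  refine (norm_add_le _ _).trans_eq ?_
  rw [norm_smul, Real.norm_eq_abs]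

/-- The Gram–Schmidt process preserves supports that are pairwise equal or disjoint. -/
theorem gramSchmidtNormed_apply_eq_zero {N : ℕ} {f : ℕ → EuclideanSpace ℝ (Fin N)}
    {T : ℕ → Set (Fin N)} (hT : ∀ i l, T i = T l ∨ Disjoint (T i) (T l))
    (hf : ∀ l, ∀ m ∉ T l, f l m = 0) (l : ℕ) (m : Fin N) (hm : m ∉ T l) :
    gramSchmidtNormed ℝ f l m = 0 := by
  suffices h : gramSchmidt ℝ f l m = 0 by simp [gramSchmidtNormed, h]
  induction l using Nat.strong_induction_on generalizing m with
  | _ l ih =>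
    rw [gramSchmidt_def, PiLp.sub_apply, hf l m hm, zero_sub, neg_eq_zero]
    have h : ∀ i ∈ Finset.Iio l, ((ℝ ∙ gramSchmidt ℝ f i).starProjection (f l)) m = 0 := by
      intro i hi
      rw [Finset.mem_Iio] at hi
      rw [Submodule.starProjection_singleton, PiLp.smul_apply]
      -- Equal supports: the earlier vector already vanishes at `m`. Disjoint supports: the
      -- projection coefficient is zero.
      rcases hT i l with hil | hil
      · rw [ih i hi m (by rwa [hil]), smul_zero]
      · have : inner ℝ (gramSchmidt ℝ f i) (f l) = 0 := by
          rw [PiLp.inner_apply]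
          refine Finset.sum_eq_zero fun m' _ => ?_
          by_cases hm' : m' ∈ T l
          · rw [ih i hi m' (Set.disjoint_right.1 hil hm'), inner_zero_left]
          · rw [hf l m' hm', inner_zero_right]
        simp [this]
    rw [WithLp.ofLp_sum, Finset.sum_apply]
    exact Finset.sum_eq_zero h

/-- Only the rows in `s` are prescribed; the others come from an arbitrary extension to an
orthonormal basis. -/
theorem exists_orthogonal_of_orthonormal {N : ℕ} {v : Fin N → EuclideanSpace ℝ (Fin N)}
    {s : Set (Fin N)} (hv : Orthonormal ℝ (s.domRestrict v)) :
    ∃ O ∈ Matrix.orthogonalGroup (Fin N) ℝ, ∀ i ∈ s, ∀ m, O i m = v i m := by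
  obtain ⟨b, hb⟩ := hv.exists_orthonormalBasis_extension_of_card_eq (by simp)
  refine ⟨Matrix.of fun i m => b i m, ?_, fun i hi m => by rw [Matrix.of_apply, hb i hi]⟩
  rw [Matrix.mem_orthogonalGroup_iff]
  ext i j
  rw [Matrix.mul_apply, Matrix.one_apply, ← orthonormal_iff_ite.1 b.orthonormal, PiLp.inner_apply]
  exact Finset.sum_congr rfl fun m _ => by simp [mul_comm]

end GramSchmidt

/-! ### Real coordinates and spectral truncation -/

section RealCoordinates

variable {N : ℕ} {H : Type*} [NormedAddCommGroup H] [InnerProductSpace ℂ H]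

/-- The real parts of the coordinates of a vector in an orthonormal basis. -/
def realCoords (b : OrthonormalBasis (Fin N) ℂ H) (u : H) : EuclideanSpace ℝ (Fin N) :=
  WithLp.toLp 2 fun m => (inner ℂ (b m) u).re

theorem sum_realCoords_smul (b : OrthonormalBasis (Fin N) ℂ H) {u : H}
    (hu : ∀ m, (inner ℂ (b m) u).im = 0) : ∑ m, (realCoords b u m : ℂ) • b m = u := by
  conv_rhs => rw [← b.sum_repr' u]
  refine Finset.sum_congr rfl fun m _ => ?_
  congr 1
  exact Complex.ext (by simp [realCoords]) (by simp [hu m])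

theorem inner_realCoords (b : OrthonormalBasis (Fin N) ℂ H) {u v : H}
    (hu : ∀ m, (inner ℂ (b m) u).im = 0) (hv : ∀ m, (inner ℂ (b m) v).im = 0) :
    inner ℝ (realCoords b u) (realCoords b v) = (inner ℂ u v).re := by
  rw [← b.sum_inner_mul_inner u v, PiLp.inner_apply, Complex.re_sum]
  refine Finset.sum_congr rfl fun m _ => ?_
  have h : inner ℂ u (b m) = starRingEnd ℂ (inner ℂ (b m) u) := (inner_conj_symm _ _).symm
  rw [h, Complex.mul_re, Complex.conj_re, Complex.conj_im, hu m, hv m]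
  simp [realCoords, mul_comm]

/-- The restriction of a vector to a set of coordinates. -/
def truncate (T : Set (Fin N)) (v : EuclideanSpace ℝ (Fin N)) : EuclideanSpace ℝ (Fin N) :=
  WithLp.toLp 2 (T.indicator v)

/-- A discarded coordinate has `|ev m - lam| ≥ ε`, so `ε` times it is dominated by the corresponding
coordinate of the eigenvector defect on the right. -/
theorem norm_truncate_realCoords_sub_le (b : OrthonormalBasis (Fin N) ℂ H) {u : H}
    (hu : ∀ m, (inner ℂ (b m) u).im = 0) {ev : Fin N → ℝ} {lam ε : ℝ} (hε : 0 < ε) :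
    ‖truncate {m | |ev m - lam| < ε} (realCoords b u) - realCoords b u‖ ≤
      ε⁻¹ * ‖∑ m, (realCoords b u m : ℂ) • (ev m : ℂ) • b m - (lam : ℂ) • u‖ := by
  have h1 : ∑ m, (realCoords b u m : ℂ) • (ev m : ℂ) • b m - (lam : ℂ) • u
      = ∑ m, ((realCoords b u m * (ev m - lam) : ℝ) : ℂ) • b m := by
    have h2 : (lam : ℂ) • u = ∑ m, (lam : ℂ) • (realCoords b u m : ℂ) • b m := by
      rw [← Finset.smul_sum, sum_realCoords_smul b hu]
    rw [h2, ← Finset.sum_sub_distrib]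
    refine Finset.sum_congr rfl fun m _ => ?_
    rw [smul_smul, smul_smul, ← sub_smul]
    congr 1
    push_cast
    ring
  rw [h1, inv_mul_eq_div, le_div_iff₀ hε]
  refine le_of_sq_le_sq ?_ (norm_nonneg _)
  rw [norm_sum_smul_sq, mul_pow, EuclideanSpace.norm_sq_eq, Finset.sum_mul]
  refine Finset.sum_le_sum fun m _ => ?_
  rw [Complex.norm_real, norm_mul, mul_pow]
  by_cases hm : |ev m - lam| < ε
  · have : (truncate {m | |ev m - lam| < ε} (realCoords b u) - realCoords b u) m = 0 := by
      simp [truncate, hm]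
    rw [this]
    simp
    positivity
  · have : (truncate {m | |ev m - lam| < ε} (realCoords b u) - realCoords b u) m
        = - realCoords b u m := by
      simp [truncate, hm]
    rw [this, norm_neg]
    refine mul_le_mul_of_nonneg_left ?_ (sq_nonneg _)
    exact pow_le_pow_left₀ hε.le (not_lt.1 hm) 2

end RealCoordinates

/-! ### Real-valued vectors, which make the rotations real -/

section RealVectors

variable {X : Type*} [TopologicalSpace X] [CompactSpace X] [TopologicalSpace.MetrizableSpace X]
  [MeasurableSpace X] [BorelSpace X]

theorem inner_im_eq_zero {ν : Measure X} {f g : Lp ℂ 2 ν} (hf : IsRealVec f) (hg : IsRealVec g) :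
    (inner ℂ f g).im = 0 := by
  have h : inner ℂ f g = ((∫ x, (g x).re * (f x).re ∂ν : ℝ) : ℂ) := by
    rw [L2.inner_def, ← integral_complex_ofReal]
    refine integral_congr_ae ?_
    filter_upwards [hf, hg] with x hfx hgx
    apply Complex.ext <;> simp [hfx, hgx, mul_comm]
  rw [h, Complex.ofReal_im]

theorem contRep_im_eq_zero {ν : Measure X} [IsFiniteMeasure ν] (k : C(X × X, ℝ)) (lam : ℝ)
    {f : Lp ℂ 2 ν} (hf : IsRealVec f) (x : X) : (contRep ν k lam f x).im = 0 := by
  have h : kernelInt ν k f x = ((∫ x', k (x, x') * (f x').re ∂ν : ℝ) : ℂ) := by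
    rw [← integral_complex_ofReal]
    refine integral_congr_ae ?_
    filter_upwards [hf] with x' hx'
    apply Complex.ext <;> simp [hx']
  rw [contRep, ContinuousMap.smul_apply, h, ← Complex.ofReal_inv, smul_eq_mul,
    ← Complex.ofReal_mul, Complex.ofReal_im]

theorem isRealVec_iota {ν : Measure X} [IsFiniteMeasure ν] {f : C(X, ℂ)}
    (hf : ∀ x, (f x).im = 0) : IsRealVec (iota ν f) := by
  filter_upwards [coeFn_iota ν f] with x hx
  rw [hx, hf]

end RealVectors

/-! ### Existence of adapted rotations -/

section Existence

open InnerProductSpace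

variable {X : Type*} [TopologicalSpace X] [CompactSpace X] [TopologicalSpace.MetrizableSpace X]
  [MeasurableSpace X] [BorelSpace X] {Φ : Flow ℝ X} {Δt : ℝ} {x₀ : X}
  {μ : Measure X} [IsProbabilityMeasure μ]
  {k : C(X × X, ℝ)} {kN : ℕ → C(X × X, ℝ)} {lamN : ∀ N, Fin N → ℝ} {lam : ℕ → ℝ}
  {e : ∀ N, OrthonormalBasis (Fin N) ℂ (DataSpace Φ Δt x₀ N)} {φ : ℕ → Lp ℂ 2 μ}

/-- Finitely many distinct values are separated; windows of radius `δ` around them are then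
disjoint. -/
theorem exists_gap (lam : ℕ → ℝ) (M : ℕ) {ε : ℝ} (hε : 0 < ε) :
    ∃ δ > 0, δ ≤ ε ∧ ∀ i < M, ∀ l < M, lam i ≠ lam l → 2 * δ ≤ |lam i - lam l| := by
  have h : ∀ᶠ δ in 𝓝[>] (0 : ℝ), δ ∈ Set.Ioi (0 : ℝ) ∧ δ ≤ ε ∧
      ∀ i ∈ Finset.range M, ∀ l ∈ Finset.range M, lam i ≠ lam l → 2 * δ ≤ |lam i - lam l| := by
    have h1 : ∀ᶠ δ in 𝓝[>] (0 : ℝ), δ ∈ Set.Ioi (0 : ℝ) := self_mem_nhdsWithin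
    have h2 : ∀ᶠ δ in 𝓝[>] (0 : ℝ), δ ∈ Set.Ioc 0 ε := Ioc_mem_nhdsGT hε
    refine h1.and ((h2.mono fun _ h => h.2).and ?_)
    refine (eventually_all_finset _).2 fun i _ => (eventually_all_finset _).2 fun l _ => ?_
    by_cases hil : lam i = lam l
    · exact Eventually.of_forall fun _ h => absurd hil h
    · have hpos : 0 < |lam i - lam l| / 2 := by
        have := abs_pos.2 (sub_ne_zero.2 hil)
        positivity
      filter_upwards [Ioc_mem_nhdsGT hpos] with δ hδ _
      linarith [hδ.2]
  obtain ⟨δ, h0, h1, h2⟩ := h.exists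
  exact ⟨δ, h0, h1, fun i hi l hl => h2 i (Finset.mem_range.2 hi) l (Finset.mem_range.2 hl)⟩

/-- The representatives of the `φ l`, sampled in `L²(μ_N)`, are almost orthonormal approximate
eigenvectors of `K_N`. Their coordinates in `e N` are truncated to eigenvalue windows and
orthonormalized, giving the prescribed rows of `O`. -/
theorem eventually_exists_rotation
    (hw : ∀ f : C(X, ℂ), Tendsto (fun N => ∫ x, f x ∂(empMeasure Φ Δt x₀ N)) atTop
      (𝓝 (∫ x, f x ∂μ))) (hk : Tendsto kN atTop (𝓝 k))
    (hφo : Orthonormal ℂ φ) (hφr : ∀ l, IsRealVec (φ l))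
    (hφ : ∀ l, kernelOp μ k (φ l) = (lam l : ℂ) • φ l)
    (he : IsDataEigenbasis Φ Δt x₀ kN lamN e) (M : ℕ) {ε : ℝ} (hε : 0 < ε) :
    ∀ᶠ N in atTop, ∃ O ∈ Matrix.orthogonalGroup (Fin N) ℝ, ∀ l < M, lam l ≠ 0 → ∀ hl : l < N,
      (∀ m, O ⟨l, hl⟩ m ≠ 0 → |lamN N m - lam l| < ε) ∧
      ‖∑ m, (O ⟨l, hl⟩ m : ℂ) • e N m - iota _ (contRep μ k (lam l) (φ l))‖ < ε := by
  obtain ⟨δ, hδ, hδε, hgap⟩ := exists_gap lam M hε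
  set S : Set ℕ := {l | l < M ∧ lam l ≠ 0} with hS
  have hSfin : S.Finite := (Set.finite_lt_nat M).subset fun l hl => hl.1
  -- For `l ∉ S` the window is empty, so `f N l = 0` and Gram–Schmidt passes over that index.
  set T : ∀ N, ℕ → Set (Fin N) := fun N l => {m | l ∈ S ∧ |lamN N m - lam l| < δ} with hT
  set u : ∀ N, ℕ → DataSpace Φ Δt x₀ N := fun N l => iota _ (contRep μ k (lam l) (φ l)) with hu
  set α : ∀ N, ℕ → EuclideanSpace ℝ (Fin N) := fun N l => realCoords (e N) (u N l) with hα
  set f : ∀ N, ℕ → EuclideanSpace ℝ (Fin N) := fun N l => truncate (T N l) (α N l) with hf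
  have hreal : ∀ N l m, (inner ℂ (e N m) (u N l)).im = 0 := fun N l m =>
    inner_im_eq_zero (he.isReal N m) (isRealVec_iota (contRep_im_eq_zero k _ (hφr l)))
  have hT_disj : ∀ N i l, T N i = T N l ∨ Disjoint (T N i) (T N l) := by
    intro N i l
    by_cases hil : (i ∈ S ↔ l ∈ S) ∧ lam i = lam l
    · left
      simp only [hT, hil.1, hil.2]
    · right
      rw [Set.disjoint_left]
      rintro m ⟨hi, hmi⟩ ⟨hl, hml⟩
      have hne : lam i ≠ lam l := fun h => hil ⟨by simp [hi, hl], h⟩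
      have h1 := hgap i hi.1 l hl.1 hne
      have h2 := abs_sub_le (lam i) (lamN N m) (lam l)
      rw [abs_sub_comm (lam i) (lamN N m)] at h2
      linarith
  -- The defect `K_N u - lam l • u` is the class of a continuous function tending uniformly to `0`,
  -- and truncation costs at most `δ⁻¹` times its norm.
  have hdefect : ∀ l ∈ S, Tendsto (fun N => ‖f N l - α N l‖) atTop (𝓝 0) := by
    intro l hl
    have hiota : iota μ (contRep μ k (lam l) (φ l)) = φ l := iota_contRep hl.2 (hφ l)
    have h1 : Tendsto (fun N => kernelInt (empMeasure Φ Δt x₀ N) (kN N) (u N l)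
        - (lam l : ℂ) • contRep μ k (lam l) (φ l)) atTop (𝓝 0) := by
      have h := tendsto_kernelInt_iota hw hk (contRep μ k (lam l) (φ l))
      rw [hiota] at h
      have h2 : (lam l : ℂ) • contRep μ k (lam l) (φ l) = kernelInt μ k (φ l) := by
        rw [contRep, smul_inv_smul₀ (by exact_mod_cast hl.2)]
      rw [h2]
      exact tendsto_sub_nhds_zero_iff.2 h
    have h2 := (tendsto_zero_iff_norm_tendsto_zero.1 h1).const_mul δ⁻¹
    rw [mul_zero] at h2
    refine squeeze_zero (fun _ => norm_nonneg _) (fun N => ?_) h2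
    have hTl : T N l = {m | |lamN N m - lam l| < δ} := by
      ext m
      exact ⟨fun h => h.2, fun h => ⟨hl, h⟩⟩
    simp only [hf, hTl]
    refine (norm_truncate_realCoords_sub_le (e N) (hreal N l) hδ).trans
      (mul_le_mul_of_nonneg_left ?_ (inv_nonneg.2 hδ.le))
    have h3 : ∑ m, (realCoords (e N) (u N l) m : ℂ) • (lamN N m : ℂ) • e N m - (lam l : ℂ) • u N l
        = iota _ (kernelInt (empMeasure Φ Δt x₀ N) (kN N) (u N l)
          - (lam l : ℂ) • contRep μ k (lam l) (φ l)) := by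
      rw [map_sub, map_smul]
      congr 1
      change _ = kernelOp _ _ (u N l)
      conv_rhs => rw [← sum_realCoords_smul (e N) (hreal N l), kernelOp_sum]
      exact Finset.sum_congr rfl fun m _ => by rw [he.eigen]
    rw [h3]
    exact norm_iota_empMeasure_le N _
  have hinner : ∀ i ∈ S, ∀ l ∈ S, Tendsto (fun N => inner ℝ (α N i) (α N l)) atTop
      (𝓝 (if i = l then 1 else 0)) := by
    intro i hi l hl
    have h := tendsto_inner_iota hw (tendsto_const_nhds (x := contRep μ k (lam i) (φ i)))
      (tendsto_const_nhds (x := contRep μ k (lam l) (φ l)))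
    rw [iota_contRep hi.2 (hφ i), iota_contRep hl.2 (hφ l), orthonormal_iff_ite.1 hφo] at h
    have h2 := (Complex.continuous_re.tendsto _).comp h
    rw [apply_ite Complex.re, Complex.one_re, Complex.zero_re] at h2
    exact h2.congr fun N => (inner_realCoords (e N) (hreal N i) (hreal N l)).symm
  have hαnorm : ∀ l ∈ S, Tendsto (fun N => ‖α N l‖) atTop (𝓝 1) := by
    intro l hl
    have h := (Real.continuous_sqrt.tendsto _).comp (hinner l hl l hl)
    rw [if_pos rfl, Real.sqrt_one] at h
    exact h.congr fun N => by
      rw [Function.comp_apply, real_inner_self_eq_norm_sq, Real.sqrt_sq (norm_nonneg _)]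
  have hfnorm : ∀ l ∈ S, Tendsto (fun N => ‖f N l‖) atTop (𝓝 1) := fun l hl =>
    tendsto_norm_of_norm_sub (hαnorm l hl) (hdefect l hl)
  have hf0 : ∀ l ∉ S, ∀ N, f N l = 0 := by
    intro l hl N
    have hTl : T N l = ∅ := Set.eq_empty_of_forall_notMem fun m hm => hl hm.1
    simp only [hf, hTl]
    ext m
    simp [truncate]
  have horth : ∀ i ∈ S, ∀ l ∈ S, i ≠ l →
      Tendsto (fun N => inner ℝ (f N i) (f N l)) atTop (𝓝 0) := by
    intro i hi l hl hil
    have h := hinner i hi l hl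
    rw [if_neg hil] at h
    exact tendsto_inner_of_norm_sub (hαnorm i hi) (hαnorm l hl) (hdefect i hi) (hdefect l hl) h
  have hgs := tendsto_gramSchmidtNormed_sub hf0 hfnorm horth
  have hev : ∀ᶠ N in atTop, ∀ l ∈ S, gramSchmidtNormed ℝ (f N) l ≠ 0 ∧
      ‖gramSchmidtNormed ℝ (f N) l - f N l‖ < ε / 2 ∧ ‖f N l - α N l‖ < ε / 2 := by
    refine (eventually_all_finite hSfin).2 fun l hl => ?_
    have h1 := tendsto_norm_of_norm_sub (hfnorm l hl) (hgs l hl)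
    filter_upwards [h1.eventually_ne one_ne_zero, (hgs l hl).eventually_lt_const (half_pos hε),
      (hdefect l hl).eventually_lt_const (half_pos hε)] with N h2 h3 h4
    exact ⟨norm_ne_zero_iff.1 h2, h3, h4⟩
  filter_upwards [hev] with N hN
  have hon : Orthonormal ℝ (({i : Fin N | (i : ℕ) ∈ S} : Set (Fin N)).domRestrict
      fun i : Fin N => gramSchmidtNormed ℝ (f N) i) := by
    refine (gramSchmidtNormed_orthonormal' (𝕜 := ℝ) (f N)).comp
      (fun i : {i : Fin N | (i : ℕ) ∈ S} => ⟨(i.1 : ℕ), (hN _ i.2).1⟩) ?_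
    intro i j hij
    exact Subtype.ext (Fin.ext (Subtype.ext_iff.1 hij))
  obtain ⟨O, hO, hOv⟩ := exists_orthogonal_of_orthonormal hon
  refine ⟨O, hO, fun l hlM hl0 hl => ?_⟩
  have hlS : l ∈ S := ⟨hlM, hl0⟩
  have hrow : ∀ m, O ⟨l, hl⟩ m = gramSchmidtNormed ℝ (f N) l m := fun m => hOv ⟨l, hl⟩ hlS m
  refine ⟨fun m hm => ?_, ?_⟩
  · by_contra hcon
    refine hm ?_
    rw [hrow]
    refine gramSchmidtNormed_apply_eq_zero (T := T N) (hT_disj N) (fun i m' hm' => ?_) l m ?_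
    · simp [hf, truncate, hm']
    · exact fun h => hcon (h.2.trans_le hδε)
  · change ‖_ - u N l‖ < ε
    rw [← sum_realCoords_smul (e N) (hreal N l), ← Finset.sum_sub_distrib]
    simp only [hrow, ← sub_smul, ← Complex.ofReal_sub]
    have h1 := norm_sum_ofReal_smul (e N) (gramSchmidtNormed ℝ (f N) l - α N l)
    simp only [PiLp.sub_apply] at h1
    rw [h1]
    have h2 := norm_sub_le_norm_sub_add_norm_sub (gramSchmidtNormed ℝ (f N) l) (f N l) (α N l)
    have h3 := hN l hlS
    linarith [h3.2.1, h3.2.2]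

/-- A diagonal argument: `Q N M` asks for control of the first `M` vectors with tolerance `1 / (M +
1)`, and each `N` uses the largest `M ≤ N` for which this is solvable. As every level is eventually
solvable, the chosen level tends to infinity. -/
theorem exists_isAdaptedRotation
    (hw : ∀ f : C(X, ℂ), Tendsto (fun N => ∫ x, f x ∂(empMeasure Φ Δt x₀ N)) atTop
      (𝓝 (∫ x, f x ∂μ))) (hk : Tendsto kN atTop (𝓝 k))
    (hφo : Orthonormal ℂ φ) (hφr : ∀ l, IsRealVec (φ l))
    (hφ : ∀ l, kernelOp μ k (φ l) = (lam l : ℂ) • φ l)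
    (he : IsDataEigenbasis Φ Δt x₀ kN lamN e) :
    ∃ O, IsAdaptedRotation μ k lam φ kN lamN e O := by
  classical
  set Q : ∀ N, ℕ → Matrix (Fin N) (Fin N) ℝ → Prop := fun N M O =>
    O ∈ Matrix.orthogonalGroup (Fin N) ℝ ∧ ∀ l < M, lam l ≠ 0 → ∀ hl : l < N,
      (∀ m, O ⟨l, hl⟩ m ≠ 0 → |lamN N m - lam l| < 1 / ((M : ℝ) + 1)) ∧
      ‖∑ m, (O ⟨l, hl⟩ m : ℂ) • e N m - iota _ (contRep μ k (lam l) (φ l))‖ < 1 / ((M : ℝ) + 1)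
    with hQ
  have hQev : ∀ M, ∀ᶠ N in atTop, ∃ O, Q N M O := fun M =>
    eventually_exists_rotation hw hk hφo hφr hφ he M (by positivity)
  -- Level `0` imposes only orthogonality, so the greatest solvable level always exists.
  have hQ0 : ∀ N, ∃ O, Q N 0 O := fun N =>
    ⟨1, one_mem _, fun l hl => absurd hl (Nat.not_lt_zero l)⟩
  have hQmono : ∀ N M M' O, M ≤ M' → Q N M' O → Q N M O := by
    intro N M M' O hMM h
    refine ⟨h.1, fun l hl hl0 hlN => ?_⟩
    have hle : 1 / ((M' : ℝ) + 1) ≤ 1 / ((M : ℝ) + 1) :=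
      one_div_le_one_div_of_le (by positivity) (by gcongr)
    obtain ⟨h1, h2⟩ := h.2 l (hl.trans_le hMM) hl0 hlN
    exact ⟨fun m hm => (h1 m hm).trans_le hle, h2.trans_le hle⟩
  have hsel : ∀ N, ∃ O, Q N (Nat.findGreatest (fun M => ∃ O, Q N M O) N) O := fun N =>
    Nat.findGreatest_spec (P := fun M => ∃ O, Q N M O) (Nat.zero_le N) (hQ0 N)
  choose O hO using hsel
  have hOM : ∀ M, ∀ᶠ N in atTop, Q N M (O N) := by
    intro M
    filter_upwards [hQev M, eventually_ge_atTop M] with N hN hMN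
    exact hQmono N M _ _ (Nat.le_findGreatest hMN hN) (hO N)
  have hcl : ∀ l, lam l ≠ 0 → ∀ ε > 0, ∀ᶠ N in atTop, ∀ (hl : l < N) (m : Fin N),
      O N ⟨l, hl⟩ m ≠ 0 → |lamN N m - lam l| < ε := by
    intro l hl0 ε hε
    obtain ⟨M, hM⟩ := exists_nat_one_div_lt hε
    -- The level must exceed `l`, to control that row, and be at least `M`, for tolerance below `ε`.
    filter_upwards [hOM (max M (l + 1))] with N hN hl m hm
    refine ((hN.2 l (by simp) hl0 hl).1 m hm).trans_le (le_trans ?_ hM.le)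
    exact one_div_le_one_div_of_le (by positivity) (by gcongr; simp)
  refine ⟨O, fun N => (hO N).1, hcl, fun l hl0 => ?_⟩
  refine tendsto_rotRep hw hk (fun N => (hO N).1) hl0 (hφ l) l (hcl l hl0) ?_
  rw [Metric.tendsto_nhds]
  intro ε hε
  obtain ⟨M, hM⟩ := exists_nat_one_div_lt hε
  filter_upwards [hOM (max M (l + 1)), eventually_gt_atTop l] with N hN hl
  rw [dist_zero_right, norm_norm, rotBasis, dif_pos hl]
  refine ((hN.2 l (by simp) hl0 hl).2).trans_le (le_trans ?_ hM.le)
  exact one_div_le_one_div_of_le (by positivity) (by gcongr; simp)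

end Existence

/-! ### Convergence of the data-driven states and effects -/

section DataConvergence

open InnerProductSpace

variable {X : Type*} [TopologicalSpace X] [CompactSpace X] [TopologicalSpace.MetrizableSpace X]
  [MeasurableSpace X] [BorelSpace X] {Φ : Flow ℝ X} {Δt : ℝ} {x₀ : X}
  {μ : Measure X} [IsProbabilityMeasure μ]
  {k : C(X × X, ℝ)} {kN : ℕ → C(X × X, ℝ)} {lamN : ∀ N, Fin N → ℝ} {lam : ℕ → ℝ}
  {e : ∀ N, OrthonormalBasis (Fin N) ℂ (DataSpace Φ Δt x₀ N)} {φ : ℕ → Lp ℂ 2 μ}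
  {O : ∀ N, Matrix (Fin N) (Fin N) ℝ}

theorem rotBasis_orthonormal (hO : ∀ N, O N ∈ Matrix.orthogonalGroup (Fin N) ℝ) {L N : ℕ}
    (hLN : L ≤ N) : Orthonormal ℂ fun i : Fin L => rotBasis e O N i := by
  rw [orthonormal_iff_ite]
  intro i j
  have hi : (i : ℕ) < N := i.2.trans_le hLN
  have hj : (j : ℕ) < N := j.2.trans_le hLN
  have h := congrFun (congrFun ((Matrix.mem_orthogonalGroup_iff _ _).1 (hO N)) ⟨i, hi⟩) ⟨j, hj⟩
  rw [Matrix.mul_apply, Matrix.one_apply] at h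
  have hij : ((⟨i, hi⟩ : Fin N) = ⟨j, hj⟩) ↔ i = j := by simp [Fin.ext_iff]
  rw [rotBasis, dif_pos hi, rotBasis, dif_pos hj, (e N).orthonormal.inner_sum]
  simp only [Complex.conj_ofReal, ← Complex.ofReal_mul, ← Complex.ofReal_sum]
  simp only [Matrix.transpose_apply, hij] at h
  rw [h]
  split_ifs <;> simp

/-- The representative drops eigenvectors with `lamN N m = 0`, whose inverse defaults to `0`. The
cluster condition with tolerance `|lam l|` shows that these eventually do not occur in row `l`. -/
theorem eventually_rotBasis_eq_iota (he : IsDataEigenbasis Φ Δt x₀ kN lamN e)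
    (hO : IsAdaptedRotation μ k lam φ kN lamN e O) {l : ℕ} (hl0 : lam l ≠ 0) :
    ∀ᶠ N in atTop, rotBasis e O N l = iota _ (rotRep kN lamN e O N l) := by
  filter_upwards [hO.cluster l hl0 |lam l| (abs_pos.2 hl0), eventually_gt_atTop l] with N hN hl
  rw [rotBasis, dif_pos hl, rotRep, dif_pos hl, map_sum]
  refine Finset.sum_congr rfl fun m _ => ?_
  rw [map_smul]
  by_cases hm : O N ⟨l, hl⟩ m = 0
  · simp [hm]
  · have h0 : lamN N m ≠ 0 := by
      intro h0
      have := hN hl m hm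
      rw [h0, zero_sub, abs_neg] at this
      exact lt_irrefl _ this
    rw [iota_contRep h0 (he.eigen N m)]

variable {ρ : Lp ℂ 2 μ →L[ℂ] Lp ℂ 2 μ}

theorem rankOne_smul_left {H : Type*} [NormedAddCommGroup H] [InnerProductSpace ℂ H] (c : ℂ)
    (a b : H) : rankOne ℂ (c • a) b = c • rankOne ℂ a b := by
  rw [map_smul, smul_apply]

theorem ContinuousDiagonalization.hasSum_rankOne (D : ContinuousDiagonalization μ ρ) :
    HasSum (fun j => rankOne ℂ ((D.r j : ℂ) • D.ξ j) (D.ξ j)) ρ := by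
  simpa only [rankOne_smul_left] using D.hasSum

theorem ContinuousDiagonalization.bound_nonneg (D : ContinuousDiagonalization μ ρ) :
    0 ≤ D.bound := (norm_nonneg _).trans (D.norm_rep_le 0)

/-- The `tsum` defining `dataOp` is meaningful only if summable; the uniform sup bound on the
representatives supplies this, since their classes in `L²(μ_N)` need not be orthonormal. -/
theorem ContinuousDiagonalization.hasSum_dataOp (D : ContinuousDiagonalization μ ρ) (N : ℕ) :
    HasSum (fun j => rankOne ℂ ((D.r j : ℂ) • iota (empMeasure Φ Δt x₀ N) (D.rep j))
      (iota (empMeasure Φ Δt x₀ N) (D.rep j))) (D.dataOp (empMeasure Φ Δt x₀ N)) := by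
  have hs : Summable fun j => (D.r j : ℂ) • rankOne ℂ (iota (empMeasure Φ Δt x₀ N) (D.rep j))
      (iota (empMeasure Φ Δt x₀ N) (D.rep j)) := by
    refine Summable.of_norm_bounded (D.r_summable.mul_right (D.bound * D.bound)) fun j => ?_
    rw [norm_smul, norm_rankOne, Complex.norm_real, Real.norm_of_nonneg (D.r_mem j).1]
    have h := (norm_iota_empMeasure_le (Φ := Φ) (Δt := Δt) (x₀ := x₀) N (D.rep j)).trans
      (D.norm_rep_le j)
    exact mul_le_mul_of_nonneg_left (mul_le_mul h h (norm_nonneg _) D.bound_nonneg) (D.r_mem j).1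
  simp only [rankOne_smul_left]
  exact hs.hasSum

/-- Each term converges by weak convergence of the measures, and the sup bound dominates the terms
by a multiple of `r j` uniformly in large `N`. -/
theorem tendsto_inner_dataOp
    (hw : ∀ f : C(X, ℂ), Tendsto (fun N => ∫ x, f x ∂(empMeasure Φ Δt x₀ N)) atTop
      (𝓝 (∫ x, f x ∂μ))) (D : ContinuousDiagonalization μ ρ) {f g : ℕ → C(X, ℂ)} {f' g' : C(X, ℂ)}
    (hf : Tendsto f atTop (𝓝 f')) (hg : Tendsto g atTop (𝓝 g')) :
    Tendsto (fun N => inner ℂ (iota (empMeasure Φ Δt x₀ N) (f N))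
        (D.dataOp (empMeasure Φ Δt x₀ N) (iota (empMeasure Φ Δt x₀ N) (g N)))) atTop
      (𝓝 (inner ℂ (iota μ f') (ρ (iota μ g')))) := by
  have h1 := hasSum_inner_apply_of_hasSum_rankOne D.hasSum_rankOne (iota μ g') (iota μ f')
  have h2 := fun N => hasSum_inner_apply_of_hasSum_rankOne
    (D.hasSum_dataOp (Φ := Φ) (Δt := Δt) (x₀ := x₀) N)
    (iota (empMeasure Φ Δt x₀ N) (g N)) (iota (empMeasure Φ Δt x₀ N) (f N))
  rw [← h1.tsum_eq]
  simp_rw [← fun N => (h2 N).tsum_eq]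
  set C := (‖g'‖ + 1) * (‖f'‖ + 1) with hC
  refine tendsto_tsum_of_dominated_convergence
    (bound := fun j => D.r j * (D.bound * D.bound * C)) (D.r_summable.mul_right _) (fun j => ?_) ?_
  · rw [← D.iota_rep j]
    simp only [inner_smul_right]
    exact (tendsto_inner_iota hw tendsto_const_nhds hg).mul
      ((tendsto_inner_iota hw hf tendsto_const_nhds).const_mul _)
  · filter_upwards [hf.norm.eventually_lt_const (lt_add_one ‖f'‖),
      hg.norm.eventually_lt_const (lt_add_one ‖g'‖)] with N hfN hgN j
    have hb := (norm_iota_empMeasure_le (Φ := Φ) (Δt := Δt) (x₀ := x₀) N (D.rep j)).trans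
      (D.norm_rep_le j)
    have hr := (D.r_mem j).1
    have hb0 := D.bound_nonneg
    have h3 : ‖inner ℂ (iota (empMeasure Φ Δt x₀ N) (D.rep j))
        (iota (empMeasure Φ Δt x₀ N) (g N))‖ ≤ D.bound * (‖g'‖ + 1) :=
      (norm_inner_le_norm _ _).trans (mul_le_mul hb
        ((norm_iota_empMeasure_le N _).trans hgN.le) (norm_nonneg _) hb0)
    have h4 : ‖inner ℂ (iota (empMeasure Φ Δt x₀ N) (f N))
        (iota (empMeasure Φ Δt x₀ N) (D.rep j))‖ ≤ (‖f'‖ + 1) * D.bound :=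
      (norm_inner_le_norm _ _).trans (mul_le_mul
        ((norm_iota_empMeasure_le N _).trans hfN.le) hb (norm_nonneg _) (by positivity))
    rw [inner_smul_right, norm_mul, norm_mul, Complex.norm_real, Real.norm_of_nonneg hr]
    calc _ ≤ D.bound * (‖g'‖ + 1) * (D.r j * ((‖f'‖ + 1) * D.bound)) := by
          gcongr
      _ = D.r j * (D.bound * D.bound * C) := by rw [hC]; ring

variable {Y : Type*} [TopologicalSpace Y]

theorem tendsto_inner_effect
    (hw : ∀ f : C(X, ℂ), Tendsto (fun N => ∫ x, f x ∂(empMeasure Φ Δt x₀ N)) atTop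
      (𝓝 (∫ x, f x ∂μ))) {ψ : C(Y × Y, unitInterval)} {ψN : ℕ → C(Y × Y, unitInterval)}
    {h : C(X, Y)} {y : Y}
    (hψ : Tendsto (fun N => featureFun (ψN N) h y) atTop (𝓝 (featureFun ψ h y)))
    {f g : ℕ → C(X, ℂ)} {f' g' : C(X, ℂ)}
    (hf : Tendsto f atTop (𝓝 f')) (hg : Tendsto g atTop (𝓝 g')) :
    Tendsto (fun N => inner ℂ (iota (empMeasure Φ Δt x₀ N) (f N))
        (effect (empMeasure Φ Δt x₀ N) (ψN N) h y (iota (empMeasure Φ Δt x₀ N) (g N)))) atTop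
      (𝓝 (inner ℂ (iota μ f') (effect μ ψ h y (iota μ g')))) := by
  simp only [effect_iota]
  exact tendsto_inner_iota hw hf (hψ.mul hg)

theorem tendsto_featureFun {ψ : C(Y × Y, unitInterval)} {ψN : ℕ → C(Y × Y, unitInterval)}
    {h : C(X, Y)} {y : Y}
    (hψ : TendstoUniformly (fun N x => ψN N (y, h x)) (fun x => ψ (y, h x)) atTop) :
    Tendsto (fun N => featureFun (ψN N) h y) atTop (𝓝 (featureFun ψ h y)) := by
  rw [ContinuousMap.tendsto_iff_tendstoUniformly]
  have hu : UniformContinuous fun t : unitInterval => ((t : ℝ) : ℂ) :=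
    Complex.isometry_ofReal.uniformContinuous.comp uniformContinuous_subtype_val
  exact hu.comp_tendstoUniformly hψ

/-- As `lam l ≠ 0` for `l < L`, all basis vectors involved are eventually classes of uniformly
convergent continuous functions, so the matrix entries converge. -/
theorem tendsto_matrixRep_data
    (hw : ∀ f : C(X, ℂ), Tendsto (fun N => ∫ x, f x ∂(empMeasure Φ Δt x₀ N)) atTop
      (𝓝 (∫ x, f x ∂μ)))
    (hφo : Orthonormal ℂ φ) (hφ : ∀ l, kernelOp μ k (φ l) = (lam l : ℂ) • φ l)
    (he : IsDataEigenbasis Φ Δt x₀ kN lamN e)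
    (hO : IsAdaptedRotation μ k lam φ kN lamN e O)
    {ψ : C(Y × Y, unitInterval)} {ψN : ℕ → C(Y × Y, unitInterval)} {h : C(X, Y)} {y : Y}
    (hψ : TendstoUniformly (fun N x => ψN N (y, h x)) (fun x => ψ (y, h x)) atTop)
    (D : ContinuousDiagonalization μ ρ) {L : ℕ} (hL : ∀ l < L, lam l ≠ 0)
    (hC : opTrace (compress φ L ρ) ≠ 0)
    (hV : validity (normalize (compress φ L ρ)) (compress φ L (effect μ ψ h y)) ≠ 0) :
    (∀ᶠ N in atTop,
      opTrace (compress (rotBasis e O N) L (D.dataOp (empMeasure Φ Δt x₀ N))) ≠ 0 ∧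
      validity (normalize (compress (rotBasis e O N) L (D.dataOp (empMeasure Φ Δt x₀ N))))
        (compress (rotBasis e O N) L (effect (empMeasure Φ Δt x₀ N) (ψN N) h y)) ≠ 0) ∧
    Tendsto (fun N => matrixRep (rotBasis e O N) L
      (condition (normalize (compress (rotBasis e O N) L (D.dataOp (empMeasure Φ Δt x₀ N))))
        (compress (rotBasis e O N) L (effect (empMeasure Φ Δt x₀ N) (ψN N) h y)))) atTop
      (𝓝 (matrixRep φ L (condition (normalize (compress φ L ρ))
        (compress φ L (effect μ ψ h y))))) := by
  have hrep : ∀ l : Fin L, iota μ (contRep μ k (lam l) (φ l)) = φ l := fun l =>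
    iota_contRep (hL l l.2) (hφ l)
  refine tendsto_matrixRep_condition_compress (hφo.comp _ Fin.val_injective) ?_
    (effect_nonneg μ ψ h y) (effect_le_one μ ψ h y)
    (Eventually.of_forall fun N => effect_nonneg _ _ _ _)
    (Eventually.of_forall fun N => effect_le_one _ _ _ _) (fun i j => ?_) (fun i j => ?_) hC hV
  · filter_upwards [eventually_ge_atTop L] with N hN using rotBasis_orthonormal hO.orthogonal hN
  · rw [← hrep i, ← hrep j]
    refine (tendsto_inner_dataOp hw D (hO.tendsto_rep i (hL i i.2))
      (hO.tendsto_rep j (hL j j.2))).congr' ?_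
    filter_upwards [eventually_rotBasis_eq_iota he hO (hL i i.2),
      eventually_rotBasis_eq_iota he hO (hL j j.2)] with N hi hj
    rw [hi, hj]
  · rw [← hrep i, ← hrep j]
    refine (tendsto_inner_effect hw (tendsto_featureFun hψ) (hO.tendsto_rep i (hL i i.2))
      (hO.tendsto_rep j (hL j j.2))).congr' ?_
    filter_upwards [eventually_rotBasis_eq_iota he hO (hL i i.2),
      eventually_rotBasis_eq_iota he hO (hL j j.2)] with N hi hj
    rw [hi, hj]

end DataConvergence

/-! ### Trace-norm convergence of conditioned compressions -/

section TraceNormConvergence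

open InnerProductSpace ContinuousLinearMap

variable {H : Type*} [NormedAddCommGroup H] [InnerProductSpace ℂ H] [CompleteSpace H]
  {ρ : H →L[ℂ] H} {r : ℕ → ℝ} {ξ : ℕ → H}

theorem opTrace_smul (c : ℂ) (T : H →L[ℂ] H) : opTrace (c • T) = c * opTrace T := by
  simp only [opTrace, smul_apply, inner_smul_right, tsum_mul_left]

/-- The factor `(opTrace T)⁻¹` occurs both in the state and in the validity, and cancels. -/
theorem condition_normalize {T e : H →L[ℂ] H} (hT : opTrace T ≠ 0) :
    condition (normalize T) e = (opTrace (T * e))⁻¹ • (CFC.sqrt e * T * CFC.sqrt e) := by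
  rw [condition, validity, normalize, smul_mul_assoc, opTrace_smul, mul_smul_comm, smul_mul_assoc,
    smul_smul, mul_inv, inv_inv, mul_right_comm, mul_inv_cancel₀ hT, one_mul]

theorem validity_normalize (T e : H →L[ℂ] H) :
    validity (normalize T) e = (opTrace T)⁻¹ * opTrace (T * e) := by
  rw [validity, normalize, smul_mul_assoc, opTrace_smul]

/-- Moving `B` across the inner product puts the trace into a form weighted by `r j`, ready for
dominated convergence under strong limits. -/
theorem opTrace_mul_mul (hr : Summable r) (hr0 : ∀ j, 0 ≤ r j) (hξ : ∀ j, ‖ξ j‖ = 1)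
    (hρ : HasSum (fun j => rankOne ℂ ((r j : ℂ) • ξ j) (ξ j)) ρ) (A B : H →L[ℂ] H) :
    opTrace (A * ρ * B) = ∑' j, (r j : ℂ) * inner ℂ (ξ j) ((B * A) (ξ j)) := by
  rw [opTrace_eq_tsum (hasSum_rankOne_mul_mul hρ A B)]
  · refine tsum_congr fun j => ?_
    rw [adjoint_inner_left, map_smul, map_smul, inner_smul_right]
    rfl
  · refine Summable.of_nonneg_of_le (fun _ => by positivity) (fun j => ?_)
      (hr.mul_left (‖adjoint B‖ * ‖A‖))
    have h1 : ‖A ((r j : ℂ) • ξ j)‖ ≤ ‖A‖ * r j := by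
      refine (A.le_opNorm _).trans_eq ?_
      rw [norm_smul, hξ, mul_one, Complex.norm_real, Real.norm_of_nonneg (hr0 j)]
    have h2 : ‖adjoint B (ξ j)‖ ≤ ‖adjoint B‖ := by
      simpa [hξ] using (adjoint B).le_opNorm (ξ j)
    calc _ ≤ ‖adjoint B‖ * (‖A‖ * r j) := by gcongr
      _ = _ := by ring

theorem norm_mul_le_one {A B : H →L[ℂ] H} (hA : ‖A‖ ≤ 1) (hB : ‖B‖ ≤ 1) : ‖A * B‖ ≤ 1 :=
  (norm_mul_le _ _).trans (mul_le_one₀ hA (norm_nonneg _) hB)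

theorem tendsto_opTrace_mul_mul (hr : Summable r) (hr0 : ∀ j, 0 ≤ r j) (hξ : ∀ j, ‖ξ j‖ = 1)
    (hρ : HasSum (fun j => rankOne ℂ ((r j : ℂ) • ξ j) (ξ j)) ρ)
    {A B : ℕ → H →L[ℂ] H} {A' B' : H →L[ℂ] H} (hA1 : ∀ L, ‖A L‖ ≤ 1) (hB1 : ∀ L, ‖B L‖ ≤ 1)
    (hA : ∀ v, Tendsto (fun L => A L v) atTop (𝓝 (A' v)))
    (hB : ∀ v, Tendsto (fun L => B L v) atTop (𝓝 (B' v))) :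
    Tendsto (fun L => opTrace (A L * ρ * B L)) atTop (𝓝 (opTrace (A' * ρ * B'))) := by
  simp only [opTrace_mul_mul hr hr0 hξ hρ]
  refine tendsto_tsum_of_dominated_convergence (bound := r) hr (fun j => ?_)
    (Eventually.of_forall fun L j => ?_)
  · exact (Filter.Tendsto.inner tendsto_const_nhds
      (tendsto_mul_apply hB1 hB hA (ξ j))).const_mul _
  · rw [norm_mul, Complex.norm_real, Real.norm_of_nonneg (hr0 j)]
    refine mul_le_of_le_one_right (hr0 j) ((norm_inner_le_norm _ _).trans ?_)
    rw [hξ, one_mul]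
    simpa [hξ] using ((B L * A L).le_of_opNorm_le (norm_mul_le_one (hB1 L) (hA1 L)) (ξ j))

theorem traceNorm_add_le_of_hasSum {J J' : Type*} {T T' : H →L[ℂ] H} {a b : J → H} {a' b' : J' → H}
    (hT : HasSum (fun j => rankOne ℂ (a j) (b j)) T) (hs : Summable fun j => ‖b j‖ * ‖a j‖)
    (hT' : HasSum (fun j => rankOne ℂ (a' j) (b' j)) T')
    (hs' : Summable fun j => ‖b' j‖ * ‖a' j‖) :
    traceNorm (T + T') ≤
      ENNReal.ofReal (∑' j, ‖b j‖ * ‖a j‖ + ∑' j, ‖b' j‖ * ‖a' j‖) := by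
  have h1 : HasSum (fun j => rankOne ℂ (Sum.elim a a' j) (Sum.elim b b' j)) (T + T') :=
    HasSum.sum (f := fun j => rankOne ℂ (Sum.elim a a' j) (Sum.elim b b' j)) hT hT'
  have h2 : HasSum (fun j => ‖Sum.elim b b' j‖ * ‖Sum.elim a a' j‖)
      (∑' j, ‖b j‖ * ‖a j‖ + ∑' j, ‖b' j‖ * ‖a' j‖) :=
    HasSum.sum (f := fun j => ‖Sum.elim b b' j‖ * ‖Sum.elim a a' j‖) hs.hasSum hs'.hasSum
  rw [← h2.tsum_eq]
  exact traceNorm_le_of_hasSum h1 h2.summable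

/-- Telescoping: the difference is `(c A - d B) ρ A* + d B ρ (A - B)*`, and each summand is a
nuclear sum whose terms are estimated with `‖A‖, ‖B‖ ≤ 1`. -/
theorem traceNorm_smul_conj_sub_le (hr : Summable r) (hr0 : ∀ j, 0 ≤ r j) (hξ : ∀ j, ‖ξ j‖ = 1)
    (hρ : HasSum (fun j => rankOne ℂ ((r j : ℂ) • ξ j) (ξ j)) ρ)
    {A B : H →L[ℂ] H} (hA : ‖A‖ ≤ 1) (hB : ‖B‖ ≤ 1) (c d : ℂ) :
    traceNorm (c • (A * ρ * adjoint A) - d • (B * ρ * adjoint B)) ≤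
      ENNReal.ofReal (∑' j, r j * ‖c • A (ξ j) - d • B (ξ j)‖
        + ∑' j, r j * (‖d‖ * ‖A (ξ j) - B (ξ j)‖)) := by
  have hA' : ∀ j, ‖A (ξ j)‖ ≤ 1 := fun j => by simpa [hξ] using A.le_of_opNorm_le hA (ξ j)
  have hB' : ∀ j, ‖B (ξ j)‖ ≤ 1 := fun j => by simpa [hξ] using B.le_of_opNorm_le hB (ξ j)
  have hs1 : Summable fun j => r j * ‖c • A (ξ j) - d • B (ξ j)‖ := by
    refine Summable.of_nonneg_of_le (fun j => mul_nonneg (hr0 j) (norm_nonneg _)) (fun j => ?_)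
      (hr.mul_right (‖c‖ + ‖d‖))
    refine mul_le_mul_of_nonneg_left ((norm_sub_le _ _).trans ?_) (hr0 j)
    rw [norm_smul, norm_smul]
    exact add_le_add (mul_le_of_le_one_right (norm_nonneg _) (hA' j))
      (mul_le_of_le_one_right (norm_nonneg _) (hB' j))
  have hs2 : Summable fun j => r j * (‖d‖ * ‖A (ξ j) - B (ξ j)‖) := by
    refine Summable.of_nonneg_of_le (fun j => mul_nonneg (hr0 j) (by positivity)) (fun j => ?_)
      (hr.mul_right (‖d‖ * 2))
    refine mul_le_mul_of_nonneg_left (mul_le_mul_of_nonneg_left ?_ (norm_nonneg _)) (hr0 j)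
    exact (norm_sub_le _ _).trans (by linarith [hA' j, hB' j])
  have hAρ := hasSum_rankOne_mul_mul hρ A (adjoint A)
  have hBρ := hasSum_rankOne_mul_mul hρ B (adjoint B)
  have hBA := hasSum_rankOne_mul_mul hρ B (adjoint A)
  rw [adjoint_adjoint] at hAρ hBρ hBA
  have h1 : HasSum (fun j => rankOne ℂ ((r j : ℂ) • (c • A (ξ j) - d • B (ξ j))) (A (ξ j)))
      (c • (A * ρ * adjoint A) - d • (B * ρ * adjoint A)) := by
    have h := (hAρ.const_smul c).sub (hBA.const_smul d)
    have heq : ∀ j, rankOne ℂ ((r j : ℂ) • (c • A (ξ j) - d • B (ξ j))) (A (ξ j))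
        = c • rankOne ℂ (A ((r j : ℂ) • ξ j)) (A (ξ j))
          - d • rankOne ℂ (B ((r j : ℂ) • ξ j)) (A (ξ j)) := fun j => by
      simp only [map_smul, map_sub, smul_apply, sub_apply, smul_sub]
      rw [smul_comm c, smul_comm d]
    simpa only [heq] using h
  have h2 : HasSum (fun j => rankOne ℂ ((r j : ℂ) • d • B (ξ j)) (A (ξ j) - B (ξ j)))
      (d • (B * ρ * adjoint A) - d • (B * ρ * adjoint B)) := by
    have h := (hBA.const_smul d).sub (hBρ.const_smul d)
    have heq : ∀ j, rankOne ℂ ((r j : ℂ) • d • B (ξ j)) (A (ξ j) - B (ξ j))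
        = d • rankOne ℂ (B ((r j : ℂ) • ξ j)) (A (ξ j))
          - d • rankOne ℂ (B ((r j : ℂ) • ξ j)) (B (ξ j)) := fun j => by
      simp only [map_smul, map_sub, smul_apply, smul_comm d]
    simpa only [heq] using h
  have hnorm1 : ∀ j, ‖A (ξ j)‖ * ‖(r j : ℂ) • (c • A (ξ j) - d • B (ξ j))‖
      ≤ r j * ‖c • A (ξ j) - d • B (ξ j)‖ := by
    intro j
    rw [norm_smul, Complex.norm_real, Real.norm_of_nonneg (hr0 j)]
    exact mul_le_of_le_one_left (mul_nonneg (hr0 j) (norm_nonneg _)) (hA' j)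
  have hnorm2 : ∀ j, ‖A (ξ j) - B (ξ j)‖ * ‖(r j : ℂ) • d • B (ξ j)‖
      ≤ r j * (‖d‖ * ‖A (ξ j) - B (ξ j)‖) := by
    intro j
    rw [norm_smul, norm_smul, Complex.norm_real, Real.norm_of_nonneg (hr0 j), mul_comm, mul_assoc,
      mul_assoc]
    refine mul_le_mul_of_nonneg_left (mul_le_mul_of_nonneg_left ?_ (norm_nonneg _)) (hr0 j)
    exact mul_le_of_le_one_left (norm_nonneg _) (hB' j)
  have hS1 := Summable.of_nonneg_of_le (fun j => by positivity) hnorm1 hs1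
  have hS2 := Summable.of_nonneg_of_le (fun j => by positivity) hnorm2 hs2
  have h3 := traceNorm_add_le_of_hasSum h1 hS1 h2 hS2
  rw [sub_add_sub_cancel] at h3
  exact h3.trans (ENNReal.ofReal_le_ofReal
    (add_le_add (hS1.tsum_le_tsum hnorm1 hs1) (hS2.tsum_le_tsum hnorm2 hs2)))

theorem tendsto_traceNorm_smul_conj_sub (hr : Summable r) (hr0 : ∀ j, 0 ≤ r j)
    (hξ : ∀ j, ‖ξ j‖ = 1) (hρ : HasSum (fun j => rankOne ℂ ((r j : ℂ) • ξ j) (ξ j)) ρ)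
    {A : ℕ → H →L[ℂ] H} {A' : H →L[ℂ] H} (hA1 : ∀ L, ‖A L‖ ≤ 1) (hA1' : ‖A'‖ ≤ 1)
    (hA : ∀ v, Tendsto (fun L => A L v) atTop (𝓝 (A' v)))
    {c : ℕ → ℂ} {c' : ℂ} (hc : Tendsto c atTop (𝓝 c')) :
    Tendsto (fun L => traceNorm (c L • (A L * ρ * adjoint (A L)) - c' • (A' * ρ * adjoint A')))
      atTop (𝓝 0) := by
  have hAn : ∀ L j, ‖A L (ξ j)‖ ≤ 1 := fun L j => by
    simpa [hξ] using (A L).le_of_opNorm_le (hA1 L) (ξ j)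
  have hAn' : ∀ j, ‖A' (ξ j)‖ ≤ 1 := fun j => by
    simpa [hξ] using A'.le_of_opNorm_le hA1' (ξ j)
  have h1 : Tendsto (fun L => ∑' j, r j * ‖c L • A L (ξ j) - c' • A' (ξ j)‖) atTop (𝓝 0) := by
    have h := tendsto_tsum_of_dominated_convergence (𝓕 := atTop)
      (f := fun L j => r j * ‖c L • A L (ξ j) - c' • A' (ξ j)‖) (g := fun _ => (0 : ℝ))
      (bound := fun j => r j * (‖c'‖ + 1 + ‖c'‖)) (hr.mul_right _) (fun j => ?_) ?_
    · simpa using h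
    · have h0 := (hc.smul (hA (ξ j))).sub_const (c' • A' (ξ j))
      simpa using h0.norm.const_mul (r j)
    · filter_upwards [hc.norm.eventually_lt_const (lt_add_one ‖c'‖)] with L hL j
      rw [Real.norm_of_nonneg (mul_nonneg (hr0 j) (norm_nonneg _))]
      refine mul_le_mul_of_nonneg_left ((norm_sub_le _ _).trans ?_) (hr0 j)
      rw [norm_smul, norm_smul]
      exact add_le_add ((mul_le_of_le_one_right (norm_nonneg _) (hAn L j)).trans hL.le)
        (mul_le_of_le_one_right (norm_nonneg _) (hAn' j))
  have h2 : Tendsto (fun L => ∑' j, r j * (‖c'‖ * ‖A L (ξ j) - A' (ξ j)‖)) atTop (𝓝 0) := by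
    have h := tendsto_tsum_of_dominated_convergence (𝓕 := atTop)
      (f := fun L j => r j * (‖c'‖ * ‖A L (ξ j) - A' (ξ j)‖)) (g := fun _ => (0 : ℝ))
      (bound := fun j => r j * (‖c'‖ * 2)) (hr.mul_right _) (fun j => ?_) ?_
    · simpa using h
    · simpa using (((hA (ξ j)).sub_const (A' (ξ j))).norm.const_mul ‖c'‖).const_mul (r j)
    · refine Eventually.of_forall fun L j => ?_
      rw [Real.norm_of_nonneg (mul_nonneg (hr0 j) (by positivity))]
      refine mul_le_mul_of_nonneg_left (mul_le_mul_of_nonneg_left ?_ (norm_nonneg _)) (hr0 j)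
      exact (norm_sub_le _ _).trans (by linarith [hAn L j, hAn' j])
  have h3 := (ENNReal.continuous_ofReal.tendsto _).comp (h1.add h2)
  rw [add_zero, ENNReal.ofReal_zero] at h3
  exact tendsto_of_tendsto_of_tendsto_of_le_of_le tendsto_const_nhds h3 (fun _ => zero_le)
    fun L => traceNorm_smul_conj_sub_le hr hr0 hξ hρ (hA1 L) hA1' _ _

/-- The leading spans increase and their union is dense. -/
theorem tendsto_leadingSpan_starProjection (φ : HilbertBasis ℕ ℂ H) (v : H) :
    Tendsto (fun L => (leadingSpan φ L).starProjection v) atTop (𝓝 v) := by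
  refine Submodule.starProjection_tendsto_self (fun L => leadingSpan φ L) ?_ v ?_
  · intro L M hLM
    refine Submodule.span_mono ?_
    rintro _ ⟨i, rfl⟩
    exact ⟨⟨i, i.2.trans_le hLM⟩, rfl⟩
  · rw [← φ.dense_span]
    refine Submodule.topologicalClosure_mono (Submodule.span_le.2 ?_)
    rintro _ ⟨i, rfl⟩
    exact Submodule.mem_iSup_of_mem (i + 1)
      (Submodule.subset_span ⟨⟨i, i.lt_succ_self⟩, rfl⟩)

theorem compress_nonneg (φ : ℕ → H) (L : ℕ) {F : H →L[ℂ] H} (hF : 0 ≤ F) :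
    0 ≤ compress φ L F :=
  (isSelfAdjoint_starProjection (leadingSpan φ L)).conjugate_nonneg hF

theorem compress_le_one (φ : ℕ → H) (L : ℕ) {F : H →L[ℂ] H} (hF : F ≤ 1) :
    compress φ L F ≤ 1 := by
  set P := (leadingSpan φ L).starProjection with hP
  have hPsa : IsSelfAdjoint P := isSelfAdjoint_starProjection _
  have hPP : P * P = P := (leadingSpan φ L).isIdempotentElem_starProjection
  -- Compressing `1 - F ≥ 0` gives `P F P ≤ P`, and `P ≤ 1`.
  have h1 : compress φ L F ≤ P := by
    have h := hPsa.conjugate_nonneg (sub_nonneg.2 hF)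
    rw [mul_sub, sub_mul, mul_one, hPP] at h
    exact sub_nonneg.1 h
  have h2 : P ≤ 1 := by
    have h := ((IsSelfAdjoint.one (H →L[ℂ] H)).sub hPsa).conjugate_nonneg (zero_le_one' (H →L[ℂ] H))
    have h3 : (1 - P) * 1 * (1 - P) = 1 - P := by
      rw [mul_one, mul_sub, sub_mul, sub_mul, hPP, mul_one, one_mul, mul_one, sub_self, sub_zero]
    rw [h3] at h
    exact sub_nonneg.1 h
  exact h1.trans h2

theorem tendsto_traceNorm_condition_compress (hr : Summable r) (hr0 : ∀ j, 0 ≤ r j)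
    (hξ : ∀ j, ‖ξ j‖ = 1) (hρ : HasSum (fun j => rankOne ℂ ((r j : ℂ) • ξ j) (ξ j)) ρ)
    (htr : opTrace ρ ≠ 0) (φ : HilbertBasis ℕ ℂ H) {F : H →L[ℂ] H} (hF0 : 0 ≤ F) (hF1 : F ≤ 1)
    (hV : validity ρ F ≠ 0) :
    (∀ᶠ L in atTop, opTrace (compress φ L ρ) ≠ 0 ∧
      validity (normalize (compress φ L ρ)) (compress φ L F) ≠ 0) ∧
    Tendsto (fun L => traceNorm
      (condition (normalize (compress φ L ρ)) (compress φ L F) - condition ρ F)) atTop (𝓝 0) := by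
  set P : ℕ → H →L[ℂ] H := fun L => (leadingSpan φ L).starProjection with hP
  have hP1 : ∀ L, ‖P L‖ ≤ 1 := fun L => (leadingSpan φ L).starProjection_norm_le
  have hPsa : ∀ L, adjoint (P L) = P L := fun L => isSelfAdjoint_starProjection (leadingSpan φ L)
  have hPlim : ∀ v, Tendsto (fun L => P L v) atTop (𝓝 ((1 : H →L[ℂ] H) v)) :=
    tendsto_leadingSpan_starProjection φ
  have hFP : ∀ v, Tendsto (fun L => (F * P L) v) atTop (𝓝 ((F * 1) v)) := fun v =>
    (F.continuous.tendsto _).comp (hPlim v)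
  have hF0L : ∀ L, 0 ≤ compress φ L F := fun L => compress_nonneg φ L hF0
  have hF1L : ∀ L, compress φ L F ≤ 1 := fun L => compress_le_one φ L hF1
  have hFL : ∀ v, Tendsto (fun L => compress φ L F v) atTop (𝓝 (F v)) := by
    intro v
    have h := tendsto_mul_apply hP1 hPlim hFP v
    rw [one_mul, mul_one] at h
    exact h
  have hFL1 : ∀ L, ‖compress φ L F‖ ≤ 1 := fun L =>
    norm_le_one_of_nonneg_of_le_one (hF0L L) (hF1L L)
  have hC : Tendsto (fun L => opTrace (compress φ L ρ)) atTop (𝓝 (opTrace ρ)) := by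
    have h := tendsto_opTrace_mul_mul hr hr0 hξ hρ hP1 hP1 hPlim hPlim
    rwa [one_mul, mul_one] at h
  have hT : Tendsto (fun L => opTrace (compress φ L ρ * compress φ L F)) atTop
      (𝓝 (opTrace (ρ * F))) := by
    -- The product of the compressions is `P ρ (P F_L)`, so both outer factors converge strongly.
    have h := tendsto_opTrace_mul_mul hr hr0 hξ hρ (B := fun L => P L * compress φ L F) hP1
      (fun L => norm_mul_le_one (hP1 L) (hFL1 L)) hPlim (tendsto_mul_apply hP1 hPlim hFL)
    rw [one_mul, one_mul] at h
    refine h.congr fun L => ?_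
    rw [← mul_assoc]
    rfl
  have hS1 : ∀ L, ‖CFC.sqrt (compress φ L F)‖ ≤ 1 := fun L => norm_sqrt_le_one (hF0L L) (hF1L L)
  have hSlim := tendsto_sqrt_apply hF0L hF1L hF0 hF1 hFL
  have hsa : ∀ G : H →L[ℂ] H, adjoint (CFC.sqrt G) = CFC.sqrt G := fun G =>
    (CFC.sqrt_nonneg G).isSelfAdjoint
  refine ⟨?_, ?_⟩
  · filter_upwards [hC.eventually_ne htr, hT.eventually_ne hV] with L h1 h2
    exact ⟨h1, by rw [validity_normalize]; exact mul_ne_zero (inv_ne_zero h1) h2⟩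
  · have h := tendsto_traceNorm_smul_conj_sub hr hr0 hξ hρ
      (A := fun L => CFC.sqrt (compress φ L F) * P L) (A' := CFC.sqrt F * 1)
      (fun L => norm_mul_le_one (hS1 L) (hP1 L))
      (by rw [mul_one]; exact norm_sqrt_le_one hF0 hF1)
      (tendsto_mul_apply hS1 hSlim hPlim) (hT.inv₀ hV)
    refine h.congr' ?_
    filter_upwards [hC.eventually_ne htr] with L hL
    rw [condition_normalize hL, condition, validity, mul_one]
    simp only [← star_eq_adjoint, star_mul]
    simp only [star_eq_adjoint, hPsa, hsa]
    simp only [compress, mul_assoc, hP]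

end TraceNormConvergence

end QMDA

end

/-! ### Assembly of the two parts -/

theorem mainTheorem1
    {X : Type*} [TopologicalSpace X] [CompactSpace X] [TopologicalSpace.MetrizableSpace X]
    [MeasurableSpace X] [BorelSpace X]
    {Y : Type*} [TopologicalSpace Y]
    -- the dynamical system and the sampling interval
    (Φ : Flow ℝ X) (μ : Measure X) [IsProbabilityMeasure μ]
    (hΦ : ∀ t : ℝ, MeasurePreserving (Φ t) μ μ)
    (Δt : ℝ) (hΔt : 0 < Δt) (hErg : Ergodic (Φ Δt) μ)
    -- the observation map
    (h : C(X, Y))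
    -- the kernels on `X`, and a real eigenbasis of `L²(X, μ)` (in decreasing modulus of the
    -- eigenvalues or in any other order)
    (k : C(X × X, ℝ)) (hk : ∀ x x', k (x, x') = k (x', x))
    (kN : X → ℕ → C(X × X, ℝ)) (hkN : ∀ x₀ N x x', kN x₀ N (x, x') = kN x₀ N (x', x))
    (hkN_lim : ∀ᵐ x₀ ∂μ, TendstoUniformly (fun N p => kN x₀ N p) k atTop)
    (lam : ℕ → ℝ)
    (φ : HilbertBasis ℕ ℂ (Lp ℂ 2 μ)) (hφ_real : ∀ l, QMDA.IsRealVec (φ l))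
    (hφ : ∀ l, QMDA.kernelOp μ k (φ l) = (lam l : ℂ) • φ l)
    -- the kernels on `Y`
    (ψ : C(Y × Y, unitInterval)) (hψ : ∀ y y', ψ (y, y') = ψ (y', y))
    (ψN : X → ℕ → C(Y × Y, unitInterval)) (hψN : ∀ x₀ N y y', ψN x₀ N (y, y') = ψN x₀ N (y', y))
    (hψN_lim : ∀ᵐ x₀ ∂μ, TendstoUniformly (fun N (p : X × X) => ψN x₀ N (h p.1, h p.2))
      (fun p => ψ (h p.1, h p.2)) atTop)
    -- a state in the class `S_C` and an observation
    (ρ : Lp ℂ 2 μ →L[ℂ] Lp ℂ 2 μ) (hρ : QMDA.IsDensityOperator ρ)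
    (D : QMDA.ContinuousDiagonalization μ ρ) (y : Y) :
    -- (a) convergence of the matrices as `N → ∞`
    ((y ∈ Set.range h ∨
        ∀ᵐ x₀ ∂μ, TendstoUniformly (fun N x => ψN x₀ N (y, h x)) (fun x => ψ (y, h x)) atTop) →
      ∀ᵐ x₀ ∂μ,
        ∀ (lamN : ∀ N, Fin N → ℝ)
          (e : ∀ N, OrthonormalBasis (Fin N) ℂ (QMDA.DataSpace Φ Δt x₀ N)),
          QMDA.IsDataEigenbasis Φ Δt x₀ (kN x₀) lamN e →
          (∃ O, QMDA.IsAdaptedRotation μ k lam φ (kN x₀) lamN e O) ∧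
          ∀ O, QMDA.IsAdaptedRotation μ k lam φ (kN x₀) lamN e O →
            ∀ L : ℕ, (∀ l < L, lam l ≠ 0) →
              QMDA.opTrace (QMDA.compress φ L ρ) ≠ 0 →
              QMDA.validity (QMDA.normalize (QMDA.compress φ L ρ))
                (QMDA.compress φ L (QMDA.effect μ ψ h y)) ≠ 0 →
              (∀ᶠ N in atTop,
                QMDA.opTrace (QMDA.compress (QMDA.rotBasis e O N) L
                  (D.dataOp (QMDA.empMeasure Φ Δt x₀ N))) ≠ 0 ∧
                QMDA.validity
                  (QMDA.normalize (QMDA.compress (QMDA.rotBasis e O N) L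
                    (D.dataOp (QMDA.empMeasure Φ Δt x₀ N))))
                  (QMDA.compress (QMDA.rotBasis e O N) L
                    (QMDA.effect (QMDA.empMeasure Φ Δt x₀ N) (ψN x₀ N) h y)) ≠ 0) ∧
              Tendsto
                (fun N => QMDA.matrixRep (QMDA.rotBasis e O N) L
                  (QMDA.condition
                    (QMDA.normalize (QMDA.compress (QMDA.rotBasis e O N) L
                      (D.dataOp (QMDA.empMeasure Φ Δt x₀ N))))
                    (QMDA.compress (QMDA.rotBasis e O N) L
                      (QMDA.effect (QMDA.empMeasure Φ Δt x₀ N) (ψN x₀ N) h y))))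
                atTop
                (𝓝 (QMDA.matrixRep φ L
                  (QMDA.condition (QMDA.normalize (QMDA.compress φ L ρ))
                    (QMDA.compress φ L (QMDA.effect μ ψ h y)))))) ∧
    -- (b) trace-norm convergence as `L → ∞`
    (QMDA.validity ρ (QMDA.effect μ ψ h y) ≠ 0 →
      (∀ᶠ L in atTop,
        QMDA.opTrace (QMDA.compress φ L ρ) ≠ 0 ∧
        QMDA.validity (QMDA.normalize (QMDA.compress φ L ρ))
          (QMDA.compress φ L (QMDA.effect μ ψ h y)) ≠ 0) ∧
      Tendsto
        (fun L => QMDA.traceNorm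
          (QMDA.condition (QMDA.normalize (QMDA.compress φ L ρ))
              (QMDA.compress φ L (QMDA.effect μ ψ h y)) -
            QMDA.condition ρ (QMDA.effect μ ψ h y)))
        atTop (𝓝 0)) := by
  have hwe := QMDA.ae_tendsto_integral_empMeasure Φ Δt μ hErg
  refine ⟨fun hy => ?_, fun hV => ?_⟩
  · have hyN : ∀ᵐ x₀ ∂μ, TendstoUniformly (fun N x => ψN x₀ N (y, h x)) (fun x => ψ (y, h x))
        atTop := by
      rcases hy with ⟨x', rfl⟩ | hy
      -- For `y = h x'` the required limit is the slice at `x'` of the uniform limit on `X × X`.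
      · filter_upwards [hψN_lim] with x₀ hx₀
        exact hx₀.comp fun x => (x', x)
      · exact hy
    -- The null set is fixed before the eigenbases, the rotations and `L` are chosen.
    filter_upwards [hwe, hkN_lim, hyN] with x₀ hw hk' hψ' lamN e he
    have hk'' : Tendsto (kN x₀) atTop (𝓝 k) :=
      ContinuousMap.tendsto_iff_tendstoUniformly.2 hk'
    exact ⟨QMDA.exists_isAdaptedRotation hw hk'' φ.orthonormal hφ_real hφ he,
      fun O hO L hL hC hV => QMDA.tendsto_matrixRep_data hw φ.orthonormal hφ he hO hψ' D hL hC hV⟩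
  · exact QMDA.tendsto_traceNorm_condition_compress D.r_summable (fun j => (D.r_mem j).1)
      (fun j => D.ξ.orthonormal.norm_eq_one j) D.hasSum_rankOne
      (by rw [hρ.trace_eq_one]; exact one_ne_zero) φ (QMDA.effect_nonneg μ ψ h y)
      (QMDA.effect_le_one μ ψ h y) hV
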